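/- Let $\Bbbk$ be a field, $q\in\Bbbk$ with $q\neq 0,1$, and let $(a_{rs})_{1\le r,s\le n}$ be the Cartan matrix of the (directed, not necessarily connected) Dynkin diagram with vertex set $\{1,\dots,n\}$ of a Weyl group $\mathcal W$ with simple reflections $\sigma_1,\dots,\sigma_n$. Thus $a_{rr}=2$, and for $r\ne s$ one has $a_{rs}=a_{sr}=0$ if $r,s$ are not joined, $a_{rs}=a_{sr}=-1$ if they are joined by a single edge, and $(a_{rs},a_{sr})=(-2,-1)$, respectively $(-3,-1)$, if they are joined by a double, respectively triple, edge with arrow from $r$ to $s$. Let $\mathcal W$ act on $\Bbbk[X^{\pm1}]=\Bbbk[X_1^{\pm1},\dots,X_n^{\pm1}]$ by algebra automorphisms with $\sigma_r(X_s)=X_sX_r^{-a_{sr}}$, put $D_r(f)=(\sigma_r(f)-f)/(1-X_r)$, let $\mathcal Z=\Bbbk[X^{\pm1}]^{\mathcal W}$, and let $\mathcal F$ be the quotient field of $\mathcal Z$. Let $\mathcal H_q$ be the affine Hecke algebra: the unital $\Bbbk$-algebra with generators $X_r^{\pm1},T_r$ ($1\le r\le n$) and relations $X_rX_s=X_sX_r$,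 $X_rX_r^{-1}=X_r^{-1}X_r=1$, $T_rX_s=\sigma_r(X_s)T_r+(1-q)D_r(X_s)$, $(T_r+1)(T_r-q)=0$, and the braid relations: $T_rT_s=T_sT_r$ if $r\neq s$ are not joined, $T_rT_sT_r=T_sT_rT_s$ if they are joined by a single edge, $(T_rT_s)^2=(T_sT_r)^2$ if they are joined by a double edge with arrow from $r$ to $s$, and $(T_rT_s)^3=(T_sT_r)^3$ if they are joined by a triple edge with arrow from $r$ to $s$. The algebra $\mathcal Z$ maps to the center of $\mathcal H_q$; let $\mathcal H_{q,\mathcal F}=\mathcal H_q\otimes_{\mathcal Z}\mathcal F$. Then the image in $\mathcal H_{q,\mathcal F}$ of every nonzero $f\in\Bbbk[X^{\pm1}]$ is invertible, and, with $\Phi_r:=T_r+(1-q)(1-X_r)^{-1}\in\mathcal H_{q,\mathcal F}$, the $\Bbbk$-algebra $\mathcal H_{q,\mathcal F}$ is generated by the elements $X_1,\dots,X_n$, $\Phi_1,\dots,\Phi_n$ and $f^{-1}$ ($0\ne f\in\Bbbk[X_1,\dots,X_n]$), subject exactly to the following relations (that is, it is canonically isomorphic to the $\Bbbk$-algebra presented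 by these generators and relations), for all $r,s$: \begin{align*} X_rX_s&=X_sX_r;\\ ff^{-1}&=f^{-1}f=1\quad\text{for all } 0\ne f\in\Bbbk[X_1,\dots,X_n];\\ \Phi_rX_s&=\sigma_r(X_s)\Phi_r;\\ \Phi_r^2&=\frac{(1-qX_r)(q-X_r)}{(1-X_r)^2};\\ \Phi_r\Phi_s&=\Phi_s\Phi_r\quad\text{if } r\neq s \text{ are not joined};\\ \Phi_r\Phi_s\Phi_r&=\Phi_s\Phi_r\Phi_s\quad\text{if } r,s \text{ are joined by a single edge};\\ (\Phi_r\Phi_s)^2&=(\Phi_s\Phi_r)^2\quad\text{if } r,s \text{ are joined by a double edge with arrow from } r \text{ to } s;\\ (\Phi_r\Phi_s)^3&=(\Phi_s\Phi_r)^3\quad\text{if } r,s \text{ are joined by a triple edge with arrow from } r \text{ to } s. \end{align*} -/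

import Mathlib

open scoped TensorProduct

noncomputable section

namespace AffineHecke

/-! ### Cartan matrices of finite type -/

/-- A Cartan matrix of finite type `(a_{rs})` on the vertex set `Fin n`: the matrix attached to the
Dynkin diagram (not necessarily connected) of a Weyl group. -/
structure FiniteCartanMatrix (n : ℕ) where
  /-- the entries `a r s = a_{rs}` -/
  a : Matrix (Fin n) (Fin n) ℤ
  diag : ∀ r, a r r = 2
  nonpos : ∀ r s, r ≠ s → a r s ≤ 0
  zero_symm : ∀ r s, a r s = 0 → a s r = 0
  finite_type : ∃ d : Fin n → ℤ, (∀ r, 0 < d r) ∧ (Matrix.diagonal d * a).PosDef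

namespace FiniteCartanMatrix

variable {n : ℕ} (A : FiniteCartanMatrix n)

/-- `r` and `s` are distinct vertices not connected by an edge. -/
def NoEdge (r s : Fin n) : Prop := A.a r s = 0 ∧ A.a s r = 0

/-- `r` and `s` are connected by a single edge. -/
def SingleEdge (r s : Fin n) : Prop := A.a r s = -1 ∧ A.a s r = -1

/-- `r` and `s` are connected by a double edge with an arrow from `r` to `s`. -/
def DoubleEdge (r s : Fin n) : Prop := A.a r s = -2 ∧ A.a s r = -1

/-- `r` and `s` are connected by a triple edge with an arrow from `r` to `s`. -/
def TripleEdge (r s : Fin n) : Prop := A.a r s = -3 ∧ A.a s r = -1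

/-- The simple reflection `e_s ↦ e_s - a_{sr} e_r` of the lattice `ℤⁿ`. -/
def latticeReflection (r : Fin n) : (Fin n → ℤ) ≃+ (Fin n → ℤ) where
  toFun v := v - Pi.single r (∑ s, v s * A.a s r)
  invFun v := v - Pi.single r (∑ s, v s * A.a s r)
  left_inv v := by
    ext t
    have h : ∑ s, (Pi.single r (∑ s, v s * A.a s r) : Fin n → ℤ) s * A.a s r
        = 2 * ∑ s, v s * A.a s r := by
      rw [Finset.sum_eq_single r]
      · rw [Pi.single_eq_same, A.diag, mul_comm]
      · intro b _ hb
        rw [Pi.single_eq_of_ne hb, zero_mul]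
      · simp
    by_cases ht : t = r
    · subst ht
      simp [sub_mul, Finset.sum_sub_distrib, h]
      ring
    · simp [Pi.single_eq_of_ne ht]
  right_inv v := by
    ext t
    have h : ∑ s, (Pi.single r (∑ s, v s * A.a s r) : Fin n → ℤ) s * A.a s r
        = 2 * ∑ s, v s * A.a s r := by
      rw [Finset.sum_eq_single r]
      · rw [Pi.single_eq_same, A.diag, mul_comm]
      · intro b _ hb
        rw [Pi.single_eq_of_ne hb, zero_mul]
      · simp
    by_cases ht : t = r
    · subst ht
      simp [sub_mul, Finset.sum_sub_distrib, h]
      ring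
    · simp [Pi.single_eq_of_ne ht]
  map_add' v w := by
    ext t
    by_cases ht : t = r
    · subst ht
      simp [add_mul, Finset.sum_add_distrib]
      ring
    · simp [Pi.single_eq_of_ne ht]

end FiniteCartanMatrix

/-! ### Laurent polynomials, the Weyl group and Demazure operators -/

/-- The Laurent polynomial ring `k[X₁^{±1}, …, Xₙ^{±1}]`. -/
abbrev Laurent (k : Type*) [Field k] (n : ℕ) := AddMonoidAlgebra k (Fin n → ℤ)

section Laurent

variable (k : Type*) [Field k] {n : ℕ}

/-- The indeterminate `X_r`. -/
def lX (r : Fin n) : Laurent k n := AddMonoidAlgebra.single (Pi.single r 1) 1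

variable (A : FiniteCartanMatrix n)

/-- The action of the simple reflection `σ_r` on Laurent polynomials by algebra automorphisms,
`σ_r(X_s) = X_s X_r^{-a_{sr}}`. -/
def simpleReflection (r : Fin n) : Laurent k n ≃ₐ[k] Laurent k n :=
  AddMonoidAlgebra.domCongr k k (A.latticeReflection r)

/-- The Weyl group, through its action on Laurent polynomials. -/
def weylGroup : Subgroup (Laurent k n ≃ₐ[k] Laurent k n) :=
  Subgroup.closure (Set.range (simpleReflection k A))

/-- The algebra `𝒵` of Weyl group invariants in `k[X^{±1}]`. -/
def invariants : Subalgebra k (Laurent k n) where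
  carrier := {f | ∀ w ∈ weylGroup k A, w f = f}
  mul_mem' hf hg w hw := by rw [map_mul, hf w hw, hg w hw]
  add_mem' hf hg w hw := by rw [map_add, hf w hw, hg w hw]
  algebraMap_mem' c w _ := w.commutes c

variable {k}

lemma one_sub_dvd_single (r : Fin n) (m : ℤ) :
    (1 - lX k r) ∣ (AddMonoidAlgebra.single (Pi.single r m) 1 - 1 : Laurent k n) := by
  have hnat : ∀ p : ℕ, (AddMonoidAlgebra.single (Pi.single r (p : ℤ)) 1 : Laurent k n)
      = lX k r ^ p := by
    intro p
    rw [lX, AddMonoidAlgebra.single_pow, one_pow, ← Pi.single_smul]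
    simp
  obtain ⟨p, rfl | rfl⟩ := m.eq_nat_or_neg
  · rw [hnat, ← dvd_neg, neg_sub]
    exact one_sub_dvd_one_sub_pow _ p
  · have h : (AddMonoidAlgebra.single (Pi.single r (-(p : ℤ))) 1 - 1 : Laurent k n)
        = AddMonoidAlgebra.single (Pi.single r (-(p : ℤ))) 1 * (1 - lX k r ^ p) := by
      rw [← hnat, mul_sub, mul_one, AddMonoidAlgebra.single_mul_single, ← Pi.single_add]
      simp [AddMonoidAlgebra.one_def]
    rw [h]
    exact Dvd.dvd.mul_left (one_sub_dvd_one_sub_pow _ p) _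

/-- `1 - X_r` divides `σ_r(f) - f`. -/
lemma one_sub_dvd (r : Fin n) (f : Laurent k n) :
    (1 - lX k r) ∣ (simpleReflection k A r f - f) := by
  induction f using AddMonoidAlgebra.induction_linear with
  | zero => simp
  | add f g hf hg =>
    rw [map_add, add_sub_add_comm]
    exact dvd_add hf hg
  | single v c =>
    have h : simpleReflection k A r (AddMonoidAlgebra.single v c) - AddMonoidAlgebra.single v c
        = AddMonoidAlgebra.single v c *
          (AddMonoidAlgebra.single (Pi.single r (-∑ s, v s * A.a s r)) 1 - 1) := by
      rw [simpleReflection, AddMonoidAlgebra.domCongr_single, mul_sub, mul_one,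
        AddMonoidAlgebra.single_mul_single, Pi.single_neg, ← sub_eq_add_neg, mul_one]
      rfl
    rw [h]
    exact Dvd.dvd.mul_left (one_sub_dvd_single r _) _

/-- The Demazure operator `D_r(f) = (σ_r(f) - f) / (1 - X_r)`, i.e. the quotient of the exact
division of `σ_r(f) - f` by `1 - X_r` in the domain `k[X^{±1}]`. -/
def demazure (r : Fin n) (f : Laurent k n) : Laurent k n := (one_sub_dvd A r f).choose

lemma demazure_spec (r : Fin n) (f : Laurent k n) :
    (1 - lX k r) * demazure A r f = simpleReflection k A r f - f :=
  (one_sub_dvd A r f).choose_spec.symm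

lemma one_sub_lX_ne_zero (r : Fin n) : (1 - lX k r) ≠ 0 := by
  intro h
  have h1 : (AddMonoidAlgebra.single (0 : Fin n → ℤ) (1 : k))
      = AddMonoidAlgebra.single (Pi.single r 1) 1 := by
    rw [← AddMonoidAlgebra.one_def]
    exact sub_eq_zero.mp h
  have h2 := congrArg (fun f => f.coeff 0) h1
  simp at h2

lemma demazure_unique (r : Fin n) (f g : Laurent k n)
    (h : (1 - lX k r) * g = simpleReflection k A r f - f) : g = demazure A r f :=
  mul_left_cancel₀ (one_sub_lX_ne_zero r) (h.trans (demazure_spec A r f).symm)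

end Laurent

/-! ### The affine Hecke algebra -/

/-- Generators `X_r`, `X_r⁻¹`, `T_r` of the affine Hecke algebra. -/
inductive HeckeGen (n : ℕ) : Type
  | X (r : Fin n)
  | Xinv (r : Fin n)
  | T (r : Fin n)

/-- Ordered evaluation of a Laurent polynomial at a family `x` with (purported) inverses `y` in a
possibly noncommutative algebra: the monomial `X^v` goes to `x₁^{v₁} ⋯ xₙ^{vₙ}`. -/
def laurentEval {k : Type*} [Field k] {n : ℕ} {B : Type*} [Ring B] [Algebra k B]
    (x y : Fin n → B) (f : Laurent k n) : B :=
  f.coeff.sum fun v c =>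
    c • (List.ofFn fun i => x i ^ (v i).toNat * y i ^ (-(v i)).toNat).prod

section Hecke

variable {k : Type*} [Field k] {n : ℕ} (A : FiniteCartanMatrix n) (q : k)

/-- The free generator `X_r`. -/
def fX (k : Type*) [Field k] {n : ℕ} (r : Fin n) : FreeAlgebra k (HeckeGen n) :=
  FreeAlgebra.ι k (HeckeGen.X r)

/-- The free generator `X_r⁻¹`. -/
def fXinv (k : Type*) [Field k] {n : ℕ} (r : Fin n) : FreeAlgebra k (HeckeGen n) :=
  FreeAlgebra.ι k (HeckeGen.Xinv r)

/-- The free generator `T_r`. -/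
def fT (k : Type*) [Field k] {n : ℕ} (r : Fin n) : FreeAlgebra k (HeckeGen n) :=
  FreeAlgebra.ι k (HeckeGen.T r)

/-- The defining relations of the (non-degenerate) affine Hecke algebra. -/
inductive HeckeRel : FreeAlgebra k (HeckeGen n) → FreeAlgebra k (HeckeGen n) → Prop
  | X_comm (r s : Fin n) : HeckeRel (fX k r * fX k s) (fX k s * fX k r)
  | X_mul_inv (r : Fin n) : HeckeRel (fX k r * fXinv k r) 1
  | inv_mul_X (r : Fin n) : HeckeRel (fXinv k r * fX k r) 1
  | T_X (r s : Fin n) : HeckeRel (fT k r * fX k s)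
      (laurentEval (fX k) (fXinv k) (simpleReflection k A r (lX k s)) * fT k r
        + (1 - q) • laurentEval (fX k) (fXinv k) (demazure A r (lX k s)))
  | quadratic (r : Fin n) :
      HeckeRel ((fT k r + 1) * (fT k r - algebraMap k _ q)) 0
  | braid2 (r s : Fin n) (h : A.NoEdge r s) :
      HeckeRel (fT k r * fT k s) (fT k s * fT k r)
  | braid3 (r s : Fin n) (h : A.SingleEdge r s) :
      HeckeRel (fT k r * fT k s * fT k r) (fT k s * fT k r * fT k s)
  | braid4 (r s : Fin n) (h : A.DoubleEdge r s) :
      HeckeRel ((fT k r * fT k s) ^ 2) ((fT k s * fT k r) ^ 2)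
  | braid6 (r s : Fin n) (h : A.TripleEdge r s) :
      HeckeRel ((fT k r * fT k s) ^ 3) ((fT k s * fT k r) ^ 3)

/-- The affine Hecke algebra `ℋ_q`. -/
abbrev HeckeAlgebra := RingQuot (HeckeRel A q)

/-- The generator `X_r` of `ℋ_q`, as a unit. -/
def hX (r : Fin n) : (HeckeAlgebra A q)ˣ where
  val := RingQuot.mkAlgHom k (HeckeRel A q) (fX k r)
  inv := RingQuot.mkAlgHom k (HeckeRel A q) (fXinv k r)
  val_inv := by
    rw [← map_mul, RingQuot.mkAlgHom_rel k (HeckeRel.X_mul_inv r), map_one]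
  inv_val := by
    rw [← map_mul, RingQuot.mkAlgHom_rel k (HeckeRel.inv_mul_X r), map_one]

/-- The generator `T_r` of `ℋ_q`. -/
def hT (r : Fin n) : HeckeAlgebra A q := RingQuot.mkAlgHom k (HeckeRel A q) (fT k r)

lemma hX_comm (r s : Fin n) : Commute (hX A q r) (hX A q s) := by
  ext
  change RingQuot.mkAlgHom k (HeckeRel A q) (fX k r) * RingQuot.mkAlgHom k (HeckeRel A q) (fX k s)
    = RingQuot.mkAlgHom k (HeckeRel A q) (fX k s) * RingQuot.mkAlgHom k (HeckeRel A q) (fX k r)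
  rw [← map_mul, RingQuot.mkAlgHom_rel k (HeckeRel.X_comm r s), map_mul]

lemma prod_ofFn_mul {M : Type*} [Monoid M] : ∀ {m : ℕ} (a b : Fin m → M),
    (∀ i j, Commute (a i) (b j)) →
    (List.ofFn fun i => a i * b i).prod = (List.ofFn a).prod * (List.ofFn b).prod
  | 0, _, _, _ => by simp
  | m + 1, a, b, h => by
    rw [List.ofFn_succ, List.ofFn_succ, List.ofFn_succ, List.prod_cons, List.prod_cons,
      List.prod_cons, prod_ofFn_mul _ _ fun i j => h i.succ j.succ]
    have hc : Commute (List.ofFn fun i : Fin m => a i.succ).prod (b 0) := by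
      refine Commute.list_prod_left _ _ fun x hx => ?_
      rw [List.mem_ofFn] at hx
      obtain ⟨i, rfl⟩ := hx
      exact h i.succ 0
    rw [mul_assoc, mul_assoc, ← mul_assoc (b 0), ← hc.eq, mul_assoc]

/-- The Laurent monomial `X^v` in the unit group of `ℋ_q`. -/
def monomialHom : Multiplicative (Fin n → ℤ) →* (HeckeAlgebra A q)ˣ where
  toFun v := (List.ofFn fun i => hX A q i ^ (v.toAdd i)).prod
  map_one' := by
    refine List.prod_eq_one fun x hx => ?_
    rw [List.mem_ofFn] at hx
    obtain ⟨i, rfl⟩ := hx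
    simp
  map_mul' v w := by
    rw [← prod_ofFn_mul _ _ fun i j => ((hX_comm A q i j).zpow_zpow _ _)]
    simp only [toAdd_mul, Pi.add_apply, zpow_add]

/-- The algebra homomorphism `k[X^{±1}] → ℋ_q` with `X_r ↦ X_r`. -/
def ofLaurent : Laurent k n →ₐ[k] HeckeAlgebra A q :=
  AddMonoidAlgebra.lift k (HeckeAlgebra A q) (Fin n → ℤ)
    ((Units.coeHom _).comp (monomialHom A q))

lemma zpow_eq_toNat {M : Type*} [Monoid M] (u : Mˣ) (m : ℤ) :
    ((u ^ m : Mˣ) : M) = (u : M) ^ m.toNat * ((u⁻¹ : Mˣ) : M) ^ (-m).toNat := by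
  obtain ⟨p, rfl | rfl⟩ := m.eq_nat_or_neg <;> simp

lemma mk_laurentEval (f : Laurent k n) :
    RingQuot.mkAlgHom k (HeckeRel A q) (laurentEval (fX k) (fXinv k) f) = ofLaurent A q f := by
  rw [laurentEval, ofLaurent, AddMonoidAlgebra.lift_apply, Finsupp.sum, Finsupp.sum, map_sum]
  refine Finset.sum_congr rfl fun v _ => ?_
  rw [map_smul]
  congr 1
  rw [map_list_prod, List.map_ofFn]
  change _ = ((Units.coeHom _) (List.ofFn fun i => hX A q i ^ (v i)).prod)
  rw [map_list_prod, List.map_ofFn]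
  congr 2
  funext i
  simp only [Function.comp, map_mul, map_pow, Units.coeHom_apply, zpow_eq_toNat]
  rfl

lemma prod_ofFn_ite {M : Type*} [Monoid M] (x : M) : ∀ {m : ℕ} (r : Fin m),
    (List.ofFn fun i => if i = r then x else 1).prod = x
  | m + 1, r => by
    rw [List.ofFn_succ, List.prod_cons]
    refine Fin.cases ?_ (fun r => ?_) r
    · simp [Fin.succ_ne_zero]
    · simp only [Fin.succ_inj, prod_ofFn_ite x r]
      rw [if_neg (Fin.succ_ne_zero r).symm, one_mul]

lemma ofLaurent_lX (r : Fin n) : ofLaurent A q (lX k r) = hX A q r := by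
  rw [ofLaurent, lX, AddMonoidAlgebra.lift_single, one_smul]
  change ((monomialHom A q (Multiplicative.ofAdd (Pi.single r 1)) : (HeckeAlgebra A q)ˣ) :
    HeckeAlgebra A q) = _
  congr 1
  change (List.ofFn fun i => hX A q i ^ ((Pi.single r 1 : Fin n → ℤ) i)).prod = _
  have : (fun i => hX A q i ^ ((Pi.single r 1 : Fin n → ℤ) i))
      = fun i => if i = r then hX A q r else 1 := by
    funext i
    by_cases h : i = r
    · subst h; simp
    · simp [h]
  rw [this]
  exact prod_ofFn_ite _ r

/-- The Leibniz rule for the Demazure operator. -/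
lemma demazure_mul (r : Fin n) (f g : Laurent k n) :
    demazure A r (f * g)
      = demazure A r f * g + simpleReflection k A r f * demazure A r g := by
  refine (demazure_unique A r _ _ ?_).symm
  rw [mul_add, ← mul_assoc, demazure_spec, mul_left_comm, demazure_spec, map_mul]
  ring

lemma demazure_add (r : Fin n) (f g : Laurent k n) :
    demazure A r (f + g) = demazure A r f + demazure A r g := by
  refine (demazure_unique A r _ _ ?_).symm
  rw [mul_add, demazure_spec, demazure_spec, map_add]
  ring

lemma demazure_of_fixed (r : Fin n) (f : Laurent k n) (hf : simpleReflection k A r f = f) :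
    demazure A r f = 0 := by
  refine (demazure_unique A r _ _ ?_).symm
  rw [mul_zero, hf, sub_self]

/-- The set of Laurent polynomials `f` for which `T_r f = σ_r(f) T_r + (1 - q) D_r(f)` holds. -/
def commSubalgebra (r : Fin n) : Subalgebra k (Laurent k n) where
  carrier := {f | hT A q r * ofLaurent A q f = ofLaurent A q (simpleReflection k A r f) * hT A q r
      + (1 - q) • ofLaurent A q (demazure A r f)}
  mul_mem' {f g} hf hg := by
    simp only [Set.mem_ofPred_eq] at hf hg ⊢
    rw [map_mul, ← mul_assoc, hf, add_mul, mul_assoc, hg, demazure_mul, map_mul, map_add, map_mul,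
      map_mul, map_mul, mul_add, smul_add, smul_mul_assoc, mul_smul_comm, mul_assoc]
    abel
  add_mem' {f g} hf hg := by
    simp only [Set.mem_ofPred_eq] at hf hg ⊢
    rw [map_add, mul_add, hf, hg, demazure_add, map_add, map_add, map_add, smul_add, add_mul]
    abel
  algebraMap_mem' c := by
    simp only [Set.mem_ofPred_eq]
    rw [demazure_of_fixed A r _ (AlgEquiv.commutes _ c), AlgEquiv.commutes, AlgHom.commutes,
      map_zero, smul_zero, add_zero, Algebra.commutes]

lemma mem_commSubalgebra (r : Fin n) (f : Laurent k n) : f ∈ commSubalgebra A q r := by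
  have hinv : ∀ f g : Laurent k n, f * g = 1 → f ∈ commSubalgebra A q r →
      g ∈ commSubalgebra A q r := by
    intro f g hfg hf
    change hT A q r * ofLaurent A q f = ofLaurent A q (simpleReflection k A r f) * hT A q r
      + (1 - q) • ofLaurent A q (demazure A r f) at hf
    change hT A q r * ofLaurent A q g = ofLaurent A q (simpleReflection k A r g) * hT A q r
      + (1 - q) • ofLaurent A q (demazure A r g)
    have hσ : simpleReflection k A r g * simpleReflection k A r f = 1 := by
      rw [← map_mul, mul_comm, hfg, map_one]
    have hD : simpleReflection k A r g * demazure A r f * g = - demazure A r g := by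
      have h := demazure_mul A r g f
      rw [mul_comm g f, hfg, demazure_of_fixed A r 1 (map_one _)] at h
      have h2 : simpleReflection k A r g * demazure A r f = - (demazure A r g * f) := by
        linear_combination -h
      rw [h2, neg_mul, mul_assoc, hfg, mul_one]
    have h1 := congrArg (fun t => ofLaurent A q (simpleReflection k A r g) * t * ofLaurent A q g) hf
    simp only [mul_add, add_mul, mul_smul_comm, smul_mul_assoc] at h1
    rw [← map_mul, ← map_mul, hD, map_neg, smul_neg] at h1
    rw [mul_assoc, mul_assoc, ← map_mul, hfg, map_one, mul_one, ← mul_assoc, ← map_mul, hσ,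
      map_one, one_mul] at h1
    rw [h1]
    abel
  have hX : ∀ s, lX k s ∈ commSubalgebra A q r := by
    intro s
    change hT A q r * ofLaurent A q (lX k s) = _
    have h := RingQuot.mkAlgHom_rel k (HeckeRel.T_X (A := A) (q := q) r s)
    rw [map_mul, map_add, map_mul, map_smul, mk_laurentEval, mk_laurentEval] at h
    rw [ofLaurent_lX]
    exact h
  have hadd : ∀ v w : Fin n → ℤ,
      (AddMonoidAlgebra.single v 1 : Laurent k n) ∈ commSubalgebra A q r →
      (AddMonoidAlgebra.single w 1 : Laurent k n) ∈ commSubalgebra A q r →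
      (AddMonoidAlgebra.single (v + w) 1 : Laurent k n) ∈ commSubalgebra A q r := by
    intro v w hv hw
    have h := mul_mem hv hw
    rwa [AddMonoidAlgebra.single_mul_single, one_mul] at h
  have hzero : (AddMonoidAlgebra.single 0 1 : Laurent k n) ∈ commSubalgebra A q r := by
    rw [← AddMonoidAlgebra.one_def]
    exact one_mem _
  have hneg : ∀ v : Fin n → ℤ,
      (AddMonoidAlgebra.single v 1 : Laurent k n) ∈ commSubalgebra A q r →
      (AddMonoidAlgebra.single (-v) 1 : Laurent k n) ∈ commSubalgebra A q r := by
    intro v hv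
    refine hinv _ _ ?_ hv
    rw [AddMonoidAlgebra.single_mul_single, one_mul, add_neg_cancel, AddMonoidAlgebra.one_def]
  have hnat : ∀ (s : Fin n) (p : ℕ),
      (AddMonoidAlgebra.single (Pi.single s (p : ℤ)) 1 : Laurent k n)
        ∈ commSubalgebra A q r := by
    intro s p
    induction p with
    | zero => simpa using hzero
    | succ p ih =>
      rw [Nat.cast_succ, Pi.single_add]
      exact hadd _ _ ih (hX s)
  have hint : ∀ (s : Fin n) (m : ℤ),
      (AddMonoidAlgebra.single (Pi.single s m) 1 : Laurent k n) ∈ commSubalgebra A q r := by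
    intro s m
    obtain ⟨p, rfl | rfl⟩ := m.eq_nat_or_neg
    · exact hnat s p
    · rw [Pi.single_neg]
      exact hneg _ (hnat s p)
  have hS : ∀ v : Fin n → ℤ,
      (AddMonoidAlgebra.single v 1 : Laurent k n) ∈ commSubalgebra A q r := by
    intro v
    rw [← Finset.univ_sum_single v]
    exact Finset.sum_induction _
      (fun v => (AddMonoidAlgebra.single v 1 : Laurent k n) ∈ commSubalgebra A q r)
      hadd hzero fun s _ => hint s _
  induction f using AddMonoidAlgebra.induction_linear with
  | zero => exact zero_mem _
  | add f g hf hg => exact add_mem hf hg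
  | single v c =>
    have h : (AddMonoidAlgebra.single v c : Laurent k n) = c • AddMonoidAlgebra.single v 1 := by
      rw [AddMonoidAlgebra.smul_single, smul_eq_mul, mul_one]
    rw [h]
    exact Subalgebra.smul_mem _ (hS v) c

/-- The commutation relation `T_r f = σ_r(f) T_r + (1 - q) D_r(f)` for Laurent polynomials. -/
lemma hT_mul_ofLaurent (r : Fin n) (f : Laurent k n) :
    hT A q r * ofLaurent A q f = ofLaurent A q (simpleReflection k A r f) * hT A q r
      + (1 - q) • ofLaurent A q (demazure A r f) :=
  mem_commSubalgebra A q r f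

/-- Weyl group invariants are central in `ℋ_q`. -/
lemma ofLaurent_central (z : invariants k A) (h : HeckeAlgebra A q) :
    Commute (ofLaurent A q z) h := by
  have hX (s : Fin n) : Commute (ofLaurent A q z) (hX A q s : HeckeAlgebra A q) := by
    rw [← ofLaurent_lX]
    exact (Commute.all (z : Laurent k n) (lX k s)).map (ofLaurent A q)
  obtain ⟨h, rfl⟩ := RingQuot.mkAlgHom_surjective k (HeckeRel A q) h
  induction h using FreeAlgebra.induction with
  | grade0 c =>
    rw [AlgHom.commutes]
    exact Algebra.commute_algebraMap_right _ _
  | grade1 g =>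
    cases g with
    | X s => exact hX s
    | Xinv s => exact (hX s).units_inv_right
    | T s =>
      have hs : simpleReflection k A s z = z :=
        z.2 _ (Subgroup.subset_closure ⟨s, rfl⟩)
      have h := hT_mul_ofLaurent A q s z
      rw [demazure_of_fixed A s _ hs, hs, map_zero, smul_zero, add_zero] at h
      exact h.symm
  | mul a b ha hb => rw [map_mul]; exact ha.mul_right hb
  | add a b ha hb => rw [map_add]; exact ha.add_right hb

/-- `ℋ_q` is an algebra over the invariants `𝒵`, which it contains as central elements. -/
instance : Algebra (invariants k A) (HeckeAlgebra A q) :=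
  ((ofLaurent A q).comp (invariants k A).val).toRingHom.toAlgebra' fun z h =>
    ofLaurent_central A q z h

instance : IsScalarTower k (invariants k A) (HeckeAlgebra A q) :=
  IsScalarTower.of_algebraMap_eq' ((ofLaurent A q).comp (invariants k A).val).comp_algebraMap.symm

/-- The rationalization `ℋ_{q,ℱ} = ℋ_q ⊗_𝒵 ℱ`, where `ℱ` is the quotient field of `𝒵`. -/
abbrev Rationalization :=
  HeckeAlgebra A q ⊗[invariants k A] FractionRing (invariants k A)

/-- A Laurent polynomial `f`, seen as the element `f ⊗ 1` of `ℋ_{q,ℱ}`. -/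
def ratOfLaurent : Laurent k n →ₐ[k] Rationalization A q :=
  (Algebra.TensorProduct.includeLeft (R := invariants k A) (S := k)).comp (ofLaurent A q)

/-- The intertwining element `Φ_r = T_r + (1 - q)(1 - X_r)⁻¹` of `ℋ_{q,ℱ}`. (The element `1 - X_r`
is invertible in `ℋ_{q,ℱ}`, as is every nonzero Laurent polynomial.) -/
def intertwiner (r : Fin n) : Rationalization A q :=
  hT A q r ⊗ₜ 1 + (1 - q) • Ring.inverse (ratOfLaurent A q (1 - lX k r))

end Hecke

/-! ### The algebra presented by the intertwining generators -/

/-- Generators `X_r`, `Φ_r` and `f⁻¹` for every nonzero polynomial `f ∈ k[X₁, …, Xₙ]`. -/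
inductive IntertwinerGen (k : Type*) [Field k] (n : ℕ) : Type _
  | X (r : Fin n)
  | Phi (r : Fin n)
  | inv (f : MvPolynomial (Fin n) k) (hf : f ≠ 0)

section Presentation

variable {k : Type*} [Field k] {n : ℕ}

/-- The free generator `X_r`. -/
def gX (k : Type*) [Field k] {n : ℕ} (r : Fin n) : FreeAlgebra k (IntertwinerGen k n) :=
  FreeAlgebra.ι k (IntertwinerGen.X r)

/-- The free generator `Φ_r`. -/
def gPhi (k : Type*) [Field k] {n : ℕ} (r : Fin n) : FreeAlgebra k (IntertwinerGen k n) :=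
  FreeAlgebra.ι k (IntertwinerGen.Phi r)

/-- The free generator `f⁻¹`. -/
def gInv (f : MvPolynomial (Fin n) k) (hf : f ≠ 0) : FreeAlgebra k (IntertwinerGen k n) :=
  FreeAlgebra.ι k (IntertwinerGen.inv f hf)

/-- The polynomial `f` as an element of the free algebra: every monomial is written as the ordered
product `X₁^{m₁} ⋯ Xₙ^{mₙ}`. -/
def gPoly (f : MvPolynomial (Fin n) k) : FreeAlgebra k (IntertwinerGen k n) :=
  ∑ m ∈ f.support, f.coeff m • (List.ofFn fun i => gX k i ^ m i).prod

/-- The integral power `X_r^m`, where negative powers use the generator `X_r⁻¹`. -/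
def gXpow (k : Type*) [Field k] {n : ℕ} (r : Fin n) (m : ℤ) : FreeAlgebra k (IntertwinerGen k n) :=
  gX k r ^ m.toNat * gInv (MvPolynomial.X r) (MvPolynomial.X_ne_zero r) ^ (-m).toNat

lemma one_sub_X_sq_ne_zero (r : Fin n) :
    ((1 - MvPolynomial.X r) ^ 2 : MvPolynomial (Fin n) k) ≠ 0 := by
  refine pow_ne_zero 2 fun h => ?_
  have h1 := congrArg (MvPolynomial.aeval (fun _ => (0 : k))) h
  simp at h1

variable (A : FiniteCartanMatrix n) (q : k)

/-- The relations of the presentation by intertwining generators. -/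
inductive IntertwinerRel :
    FreeAlgebra k (IntertwinerGen k n) → FreeAlgebra k (IntertwinerGen k n) → Prop
  | X_comm (r s : Fin n) : IntertwinerRel (gX k r * gX k s) (gX k s * gX k r)
  | mul_inv (f : MvPolynomial (Fin n) k) (hf : f ≠ 0) : IntertwinerRel (gPoly f * gInv f hf) 1
  | inv_mul (f : MvPolynomial (Fin n) k) (hf : f ≠ 0) : IntertwinerRel (gInv f hf * gPoly f) 1
  | Phi_X (r s : Fin n) : IntertwinerRel (gPhi k r * gX k s)
      (gX k s * gXpow k r (-A.a s r) * gPhi k r)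
  | Phi_sq (r : Fin n) : IntertwinerRel (gPhi k r ^ 2)
      ((1 - q • gX k r) * (algebraMap k _ q - gX k r)
        * gInv ((1 - MvPolynomial.X r) ^ 2) (one_sub_X_sq_ne_zero r))
  | braid2 (r s : Fin n) (h : A.NoEdge r s) :
      IntertwinerRel (gPhi k r * gPhi k s) (gPhi k s * gPhi k r)
  | braid3 (r s : Fin n) (h : A.SingleEdge r s) :
      IntertwinerRel (gPhi k r * gPhi k s * gPhi k r) (gPhi k s * gPhi k r * gPhi k s)
  | braid4 (r s : Fin n) (h : A.DoubleEdge r s) :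
      IntertwinerRel ((gPhi k r * gPhi k s) ^ 2) ((gPhi k s * gPhi k r) ^ 2)
  | braid6 (r s : Fin n) (h : A.TripleEdge r s) :
      IntertwinerRel ((gPhi k r * gPhi k s) ^ 3) ((gPhi k s * gPhi k r) ^ 3)

/-- The `k`-algebra presented by the intertwining generators and their relations. -/
abbrev IntertwinerAlgebra := RingQuot (IntertwinerRel A q)

/-- The image of a generator in the presented algebra. -/
def IntertwinerAlgebra.gen (g : IntertwinerGen k n) : IntertwinerAlgebra A q :=
  RingQuot.mkAlgHom k (IntertwinerRel A q) (FreeAlgebra.ι k g)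

/-- A polynomial `f ∈ k[X₁, …, Xₙ]` as an element of `ℋ_{q,ℱ}`. -/
def ratOfPoly : MvPolynomial (Fin n) k →ₐ[k] Rationalization A q :=
  (ratOfLaurent A q).comp (MvPolynomial.aeval (lX k))

end Presentation

end AffineHecke

end

/-! Put c_r = (q - X_r)/(1 - X_r). Then T_r + 1 = Φ_r + c_r, so over the rational functions the T_r
and the Φ_r determine each other, and the two lists of relations are compared inside an arbitrary,
possibly noncommutative, algebra receiving k(X₁, …, Xₙ). The comparison is made on defects, that is,
left side minus right side of each relation. The defect of the commutation relation of T_r with f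
equals that of Φ_r f = σ_r(f) Φ_r (`heckeOf_mul_sub`); the defect of the quadratic relation equals
Φ_r² - c_r(1 + q - c_r) (`quadratic_heckeOf`), and c_r(1 + q - c_r) is the required right side. Once
these hold, the defects of the braid relations agree as well
(`IntertwinerSystem.braidRelations_iff`).

The braid relations are the real work. With C = T₁ + 1 and D = T₂ + 1 one has C² = (1 + q)C and D² =
(1 + q)D, and the difference of the two braid words in T becomes a difference of two alternating
expressions in C and D, for instance (CDC - qC) - (DCD - qD). Each of them, when it is expanded in
Φ₁ and Φ₂, has as coefficient of a Φ-word w the product of the values c_β = (q - X^β)/(1 - X^β) over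
the positive roots β with w⁻¹β still positive. This description does not depend on which simple root
is named first, so all terms cancel except the two longest Φ-words. The only inputs are c_{-β} = 1 +
q - c_β and one relation between c_β, c_{β+γ} and c_γ (`RootRel`).

It remains to have rational functions on both sides. In the presented algebra polynomials are
invertible by decree, and Laurent polynomials differ from polynomials by units. In the
rationalization, the norm of f over the Weyl group is a nonzero invariant divisible by f; the group
is finite because it acts on the lattice by isometries of a positive definite integral form. The
equality of defects then gives homomorphisms in both directions, and generators show that they are
mutually inverse. No basis theorem for the Hecke algebra enters. -/

open scoped TensorProduct

set_option linter.unusedSimpArgs false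

noncomputable section

namespace AffineHecke

/-! ### Braid relations in rank two -/

section RankTwo

variable {K B : Type*} [CommRing K] [Ring B] [Module K B]

/-- A pair of elements which twist scalars by `σ₁, σ₂` and whose squares are the scalars
`cᵢ (1 + q - cᵢ)`. -/
structure TwistedPair (q : K) (σ₁ σ₂ : K →+* K) (c₁ c₂ : K) (Φ₁ Φ₂ : B) : Prop where
  fixed₁ : σ₁ q = q
  fixed₂ : σ₂ q = q
  reflect₁ : σ₁ c₁ = 1 + q - c₁
  reflect₂ : σ₂ c₂ = 1 + q - c₂
  twist₁ : ∀ (f : K) (x : B), Φ₁ * f • x = σ₁ f • (Φ₁ * x)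
  twist₂ : ∀ (f : K) (x : B), Φ₂ * f • x = σ₂ f • (Φ₂ * x)
  square₁ : ∀ x : B, Φ₁ * (Φ₁ * x) = (c₁ * (1 + q - c₁)) • x
  square₂ : ∀ x : B, Φ₂ * (Φ₂ * x) = (c₂ * (1 + q - c₂)) • x

/-- The relation between the values of `(q - X) / (1 - X)` at `x`, `xz` and `z`. -/
def RootRel (q a b c : K) : Prop := a * c - b * (a + c) + (1 + q) * b - q = 0

lemma RootRel.symm {q a b c : K} (h : RootRel q a b c) : RootRel q c b a := by
  unfold RootRel at *
  linear_combination h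

/-! ### Expansion of alternating products of T₁ + 1 and T₂ + 1 into Φ-words. -/

namespace TwistedPair

variable {q : K} {σ₁ σ₂ : K →+* K} {a b c₁ c₂ c₃ c₄ c₅ c₆ : K} {Φ₁ Φ₂ : B}

lemma symm (h : TwistedPair q σ₁ σ₂ a b Φ₁ Φ₂) : TwistedPair q σ₂ σ₁ b a Φ₂ Φ₁ :=
  ⟨h.2, h.1, h.4, h.3, h.6, h.5, h.8, h.7⟩

/-- The element Φ₂ + b plays the role of T₂ + 1, on which T₂ acts from the left by q; hence Φ₂ = T₂
+ 1 - b acts by 1 + q - b. -/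
lemma mul_add_smul_one (h : TwistedPair q σ₁ σ₂ a b Φ₁ Φ₂) :
    Φ₂ * (Φ₂ + b • 1) = (1 + q - b) • (Φ₂ + b • 1) := by
  have hs := h.square₂ 1
  rw [mul_one] at hs
  rw [mul_add, hs, h.twist₂, mul_one, h.reflect₂]
  module

lemma mul_mul_self [IsScalarTower K B B] (h : TwistedPair q σ₁ σ₂ a b Φ₁ Φ₂) (x : B) :
    (Φ₂ + b • 1) * ((Φ₂ + b • 1) * x) = (1 + q) • ((Φ₂ + b • 1) * x) := by
  rw [← mul_assoc, add_mul, h.mul_add_smul_one, smul_one_mul, ← add_smul, smul_mul_assoc]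
  congr 1
  ring

lemma add_mul_smul [IsScalarTower K B B] (h : TwistedPair q σ₁ σ₂ a b Φ₁ Φ₂) (x : B) :
    (Φ₂ + b • 1) * q • x = q • ((Φ₂ + b • 1) * x) := by
  rw [add_mul, add_mul, h.twist₂, h.fixed₂, smul_one_mul, smul_one_mul, smul_add, smul_comm]

/-- For v = T₂ + 1 the left side is the last step of the recursion N_{j+1} = (T_i + 1) N_j - q
N_{j-1}, with i alternating, which produces the sum of the T-words of all elements of the dihedral
group. The numbers c₁, c₂, c₃ belong to the positive roots, listed from one simple root to the
other. Only the eigenvalue of Φ₂ on v is used, so the rightmost factor need not be expanded. -/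
lemma expand_three (h : TwistedPair q σ₁ σ₂ c₁ c₃ Φ₁ Φ₂)
    (b1 : σ₂ c₁ = c₂) (r123 : RootRel q c₁ c₂ c₃)
    (v N₂ : B) (hv : Φ₂ * v = (1 + q - c₃) • v)
    (h2 : N₂ = Φ₁ * v + c₁ • v) :
    Φ₂ * N₂ + c₃ • N₂ - q • v =
      Φ₂ * (Φ₁ * v) + c₃ • (Φ₁ * v) + (c₁ * c₂) • v := by
  subst h2
  simp only [mul_add, mul_sub, h.twist₁, h.twist₂, h.square₁, h.square₂, hv, smul_add, smul_sub,
    map_mul, map_add, map_sub, map_one, h.fixed₁, h.fixed₂, h.reflect₁, h.reflect₂, b1]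
  unfold RootRel at *
  clear h hv b1
  -- All scalars now stand to the left of the Φ-words; equality of coefficients is an identity in
  -- the cᵢ modulo the root relations.
  match_scalars <;> first | ring1 | grind (ringSteps := 1000000)

/-- In type B₂ the additive relations between the positive roots are not symmetric under reversing
their order, so the expansion is needed twice: here Φ₁ belongs to the short simple root, with roots
α, 2α + β, α + β, β. The relations used are α + β = (α) + (β) and 2α + β = (α) + (α + β). -/
lemma expand_four_short (h : TwistedPair q σ₁ σ₂ c₁ c₄ Φ₁ Φ₂)
    (a3 : σ₁ c₃ = c₃) (a4 : σ₁ c₄ = c₂) (b1 : σ₂ c₁ = c₃)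
    (r134 : RootRel q c₁ c₃ c₄) (r123 : RootRel q c₁ c₂ c₃)
    (v N₂ N₃ : B) (hv : Φ₂ * v = (1 + q - c₄) • v)
    (h2 : N₂ = Φ₁ * v + c₁ • v) (h3 : N₃ = Φ₂ * N₂ + c₄ • N₂ - q • v) :
    Φ₁ * N₃ + c₁ • N₃ - q • N₂ =
      Φ₁ * (Φ₂ * (Φ₁ * v)) + c₁ • (Φ₂ * (Φ₁ * v)) + (c₃ * c₄) • (Φ₁ * v) + (c₁ * c₂ * c₃) • v := by
  subst h3 h2
  simp only [mul_add, mul_sub, h.twist₁, h.twist₂, h.square₁, h.square₂, hv, smul_add, smul_sub,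
    map_mul, map_add, map_sub, map_one, h.fixed₁, h.fixed₂, h.reflect₁, h.reflect₂,
    a3, a4, b1]
  unfold RootRel at *
  clear h hv a3 a4 b1
  match_scalars <;> first | ring1 | grind (ringSteps := 1000000)

/-- The same expansion with Φ₁ attached to the long simple root; only the triples of roots in
additive relation change. -/
lemma expand_four_long (h : TwistedPair q σ₁ σ₂ c₁ c₄ Φ₁ Φ₂)
    (a3 : σ₁ c₃ = c₃) (a4 : σ₁ c₄ = c₂) (b1 : σ₂ c₁ = c₃)
    (r124 : RootRel q c₁ c₂ c₄) (r234 : RootRel q c₂ c₃ c₄)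
    (v N₂ N₃ : B) (hv : Φ₂ * v = (1 + q - c₄) • v)
    (h2 : N₂ = Φ₁ * v + c₁ • v) (h3 : N₃ = Φ₂ * N₂ + c₄ • N₂ - q • v) :
    Φ₁ * N₃ + c₁ • N₃ - q • N₂ =
      Φ₁ * (Φ₂ * (Φ₁ * v)) + c₁ • (Φ₂ * (Φ₁ * v)) + (c₃ * c₄) • (Φ₁ * v) + (c₁ * c₂ * c₃) • v := by
  subst h3 h2
  simp only [mul_add, mul_sub, h.twist₁, h.twist₂, h.square₁, h.square₂, hv, smul_add, smul_sub,
    map_mul, map_add, map_sub, map_one, h.fixed₁, h.fixed₂, h.reflect₁, h.reflect₂,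
    a3, a4, b1]
  unfold RootRel at *
  clear h hv a3 a4 b1
  match_scalars <;> first | ring1 | grind (ringSteps := 1000000)

/-- Type G₂ with Φ₁ attached to the short simple root α: the indices 1 to 6 stand for α, 3α + β, 2α
+ β, 3α + 2β, α + β, β, and each hypothesis `rijk` says that root j is the sum of roots i and k. -/
lemma expand_six_short (h : TwistedPair q σ₁ σ₂ c₁ c₆ Φ₁ Φ₂)
    (a2 : σ₁ c₂ = c₆) (a3 : σ₁ c₃ = c₅) (a4 : σ₁ c₄ = c₄) (a5 : σ₁ c₅ = c₃) (a6 : σ₁ c₆ = c₂)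
    (b1 : σ₂ c₁ = c₅) (b2 : σ₂ c₂ = c₄) (b3 : σ₂ c₃ = c₃) (b5 : σ₂ c₅ = c₁)
    (r156 : RootRel q c₁ c₅ c₆) (r135 : RootRel q c₁ c₃ c₅) (r123 : RootRel q c₁ c₂ c₃)
    (r246 : RootRel q c₂ c₄ c₆) (r345 : RootRel q c₃ c₄ c₅)
    (v N₂ N₃ N₄ N₅ : B) (hv : Φ₂ * v = (1 + q - c₆) • v)
    (h2 : N₂ = Φ₁ * v + c₁ • v) (h3 : N₃ = Φ₂ * N₂ + c₆ • N₂ - q • v)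
    (h4 : N₄ = Φ₁ * N₃ + c₁ • N₃ - q • N₂) (h5 : N₅ = Φ₂ * N₄ + c₆ • N₄ - q • N₃) :
    Φ₁ * N₅ + c₁ • N₅ - q • N₄ =
      Φ₁ * (Φ₂ * (Φ₁ * (Φ₂ * (Φ₁ * v)))) + c₁ • (Φ₂ * (Φ₁ * (Φ₂ * (Φ₁ * v)))) +
        (c₅ * c₆) • (Φ₁ * (Φ₂ * (Φ₁ * v))) + (c₁ * c₂ * c₃) • (Φ₂ * (Φ₁ * v)) +
        (c₃ * c₄ * c₅ * c₆) • (Φ₁ * v) + (c₁ * c₂ * c₃ * c₄ * c₅) • v := by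
  subst h5 h4 h3 h2
  simp only [mul_add, mul_sub, h.twist₁, h.twist₂, h.square₁, h.square₂, hv, smul_add, smul_sub,
    map_mul, map_add, map_sub, map_one, h.fixed₁, h.fixed₂, h.reflect₁, h.reflect₂,
    a2, a3, a4, a5, a6, b1, b2, b3, b5]
  unfold RootRel at *
  clear h hv a2 a3 a4 a5 a6 b1 b2 b3 b5
  match_scalars <;> first | ring1 | grind (ringSteps := 1000000)

lemma expand_six_long (h : TwistedPair q σ₁ σ₂ c₁ c₆ Φ₁ Φ₂)
    (a2 : σ₁ c₂ = c₆) (a3 : σ₁ c₃ = c₅) (a4 : σ₁ c₄ = c₄) (a5 : σ₁ c₅ = c₃) (a6 : σ₁ c₆ = c₂)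
    (b1 : σ₂ c₁ = c₅) (b2 : σ₂ c₂ = c₄) (b3 : σ₂ c₃ = c₃) (b5 : σ₂ c₅ = c₁)
    (r126 : RootRel q c₁ c₂ c₆) (r246 : RootRel q c₂ c₄ c₆) (r456 : RootRel q c₄ c₅ c₆)
    (r135 : RootRel q c₁ c₃ c₅) (r234 : RootRel q c₂ c₃ c₄)
    (v N₂ N₃ N₄ N₅ : B) (hv : Φ₂ * v = (1 + q - c₆) • v)
    (h2 : N₂ = Φ₁ * v + c₁ • v) (h3 : N₃ = Φ₂ * N₂ + c₆ • N₂ - q • v)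
    (h4 : N₄ = Φ₁ * N₃ + c₁ • N₃ - q • N₂) (h5 : N₅ = Φ₂ * N₄ + c₆ • N₄ - q • N₃) :
    Φ₁ * N₅ + c₁ • N₅ - q • N₄ =
      Φ₁ * (Φ₂ * (Φ₁ * (Φ₂ * (Φ₁ * v)))) + c₁ • (Φ₂ * (Φ₁ * (Φ₂ * (Φ₁ * v)))) +
        (c₅ * c₆) • (Φ₁ * (Φ₂ * (Φ₁ * v))) + (c₁ * c₂ * c₃) • (Φ₂ * (Φ₁ * v)) +
        (c₃ * c₄ * c₅ * c₆) • (Φ₁ * v) + (c₁ * c₂ * c₃ * c₄ * c₅) • v := by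
  subst h5 h4 h3 h2
  simp only [mul_add, mul_sub, h.twist₁, h.twist₂, h.square₁, h.square₂, hv, smul_add, smul_sub,
    map_mul, map_add, map_sub, map_one, h.fixed₁, h.fixed₂, h.reflect₁, h.reflect₂,
    a2, a3, a4, a5, a6, b1, b2, b3, b5]
  unfold RootRel at *
  clear h hv a2 a3 a4 a5 a6 b1 b2 b3 b5
  match_scalars <;> first | ring1 | grind (ringSteps := 1000000)

end TwistedPair

end RankTwo

/-! ### Braid words in T rewritten through C = T₁ + 1 and D = T₂ + 1. -/

section HeckeWords

variable {K B : Type*} [CommRing K] [Ring B] [Module K B] {q : K} {C D : B}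

/-- Every shorter T-word occurs in both sums over the dihedral group and cancels, so the difference
of the longest words is the difference of the full sums CDC - qC and DCD - qD. -/
lemma braid_sub_three (h1 : ∀ x, C * (C * x) = (1 + q) • (C * x))
    (h2 : ∀ x, D * (D * x) = (1 + q) • (D * x)) :
    (C - 1) * ((D - 1) * (C - 1)) - (D - 1) * ((C - 1) * (D - 1)) =
      (C * (D * C) - q • C) - (D * (C * D) - q • D) := by
  have h1' := h1 1
  have h2' := h2 1
  rw [mul_one] at h1' h2'
  simp only [sub_mul, mul_sub, one_mul, mul_one, h1, h2, h1', h2', add_smul, mul_add, one_smul]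
  module

lemma braid_sub_four (h1 : ∀ x, C * (C * x) = (1 + q) • (C * x))
    (h2 : ∀ x, D * (D * x) = (1 + q) • (D * x))
    (h3 : ∀ x, C * q • x = q • (C * x)) (h4 : ∀ x, D * q • x = q • (D * x)) :
    (C - 1) * ((D - 1) * ((C - 1) * (D - 1))) - (D - 1) * ((C - 1) * ((D - 1) * (C - 1))) =
      (C * (D * (C * D)) - 2 • q • (C * D)) - (D * (C * (D * C)) - 2 • q • (D * C)) := by
  have h1' := h1 1
  have h2' := h2 1
  rw [mul_one] at h1' h2'
  simp only [sub_mul, mul_sub, one_mul, mul_one, h1, h2, h1', h2', add_smul, mul_add, h3, h4,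
    one_smul]
  module

/-- The coefficients 4 and 3 come from solving N_{j+1} = (T_i + 1) N_j - q N_{j-1} up to j = 5, just
as 2 appears for words of length four. -/
lemma braid_sub_six (h1 : ∀ x, C * (C * x) = (1 + q) • (C * x))
    (h2 : ∀ x, D * (D * x) = (1 + q) • (D * x))
    (h3 : ∀ x, C * q • x = q • (C * x)) (h4 : ∀ x, D * q • x = q • (D * x)) :
    (C - 1) * ((D - 1) * ((C - 1) * ((D - 1) * ((C - 1) * (D - 1))))) -
        (D - 1) * ((C - 1) * ((D - 1) * ((C - 1) * ((D - 1) * (C - 1))))) =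
      (C * (D * (C * (D * (C * D)))) - 4 • q • (C * (D * (C * D))) + 3 • q • q • (C * D)) -
        (D * (C * (D * (C * (D * C)))) - 4 • q • (D * (C * (D * C))) + 3 • q • q • (D * C)) := by
  have h1' := h1 1
  have h2' := h2 1
  rw [mul_one] at h1' h2'
  simp only [sub_mul, mul_sub, one_mul, mul_one, h1, h2, h1', h2', add_smul, mul_add, h3, h4,
    one_smul]
  module

end HeckeWords

/-! ### Equality of the braid defects of the T's and of the Φ's. -/

namespace TwistedPair

variable {K B : Type*} [CommRing K] [Ring B] [Module K B] [IsScalarTower K B B]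
variable {q : K} {σ₁ σ₂ : K →+* K} {c₁ c₂ c₃ c₄ c₅ c₆ : K} {Φ₁ Φ₂ T₁ T₂ : B}

lemma braid_two (h : TwistedPair q σ₁ σ₂ c₁ c₂ Φ₁ Φ₂) (a2 : σ₁ c₂ = c₂) (b1 : σ₂ c₁ = c₁)
    (h₁ : T₁ + 1 = Φ₁ + c₁ • 1) (h₂ : T₂ + 1 = Φ₂ + c₂ • 1) :
    T₁ * T₂ - T₂ * T₁ = Φ₁ * Φ₂ - Φ₂ * Φ₁ := by
  obtain rfl := eq_sub_of_add_eq h₁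
  obtain rfl := eq_sub_of_add_eq h₂
  simp only [mul_add, add_mul, mul_sub, sub_mul, mul_one, one_mul, h.twist₁, h.twist₂, a2, b1,
    smul_one_mul]
  module

lemma add_smul_one_mul (c : K) (Φ x : B) : (Φ + c • 1) * x = Φ * x + c • x := by
  rw [add_mul, smul_one_mul]

lemma add_smul_one_mul_sub (c : K) (Φ x y : B) :
    (Φ + c • 1) * x - y = Φ * x + c • x - y := by
  rw [add_mul, smul_one_mul]

/-- The expansion is applied to the pair and to the swapped pair, whose root list is reversed.
Moving the coefficients of the last factor to the left makes the two expansions agree on all words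
but the longest. -/
lemma braid_three (h : TwistedPair q σ₁ σ₂ c₁ c₃ Φ₁ Φ₂)
    (a2 : σ₁ c₂ = c₃) (a3 : σ₁ c₃ = c₂) (b1 : σ₂ c₁ = c₂) (b2 : σ₂ c₂ = c₁)
    (r : RootRel q c₁ c₂ c₃)
    (h₁ : T₁ + 1 = Φ₁ + c₁ • 1) (h₂ : T₂ + 1 = Φ₂ + c₃ • 1) :
    T₁ * T₂ * T₁ - T₂ * T₁ * T₂ = Φ₁ * Φ₂ * Φ₁ - Φ₂ * Φ₁ * Φ₂ := by
  have e₁ := h.expand_three b1 r _ _ h.mul_add_smul_one (add_smul_one_mul _ _ _)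
  have e₂ := h.symm.expand_three a3 r.symm _ _ h.symm.mul_add_smul_one
    (add_smul_one_mul _ _ _)
  rw [← add_smul_one_mul] at e₁ e₂
  obtain rfl := eq_sub_of_add_eq h₁
  obtain rfl := eq_sub_of_add_eq h₂
  simp only [mul_assoc]
  rw [braid_sub_three h.symm.mul_mul_self h.mul_mul_self, e₁, e₂]
  simp only [mul_add, h.twist₁, h.twist₂, mul_one, a2, a3, b1, b2]
  module

/-- The first element must belong to the short simple root; swapping the pair turns the short
expansion into the long one. -/
lemma braid_four (h : TwistedPair q σ₁ σ₂ c₁ c₄ Φ₁ Φ₂)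
    (a2 : σ₁ c₂ = c₄) (a3 : σ₁ c₃ = c₃) (a4 : σ₁ c₄ = c₂) (b1 : σ₂ c₁ = c₃) (b2 : σ₂ c₂ = c₂)
    (b3 : σ₂ c₃ = c₁) (r134 : RootRel q c₁ c₃ c₄) (r123 : RootRel q c₁ c₂ c₃)
    (h₁ : T₁ + 1 = Φ₁ + c₁ • 1) (h₂ : T₂ + 1 = Φ₂ + c₄ • 1) :
    (T₁ * T₂) ^ 2 - (T₂ * T₁) ^ 2 = (Φ₁ * Φ₂) ^ 2 - (Φ₂ * Φ₁) ^ 2 := by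
  have e₁ := h.expand_four_short a3 a4 b1 r134 r123 _ _ _ h.mul_add_smul_one
    (add_smul_one_mul _ _ _) (add_smul_one_mul_sub _ _ _ _)
  have e₂ := h.symm.expand_four_long b2 b1 a4 r134.symm r123.symm _ _ _
    h.symm.mul_add_smul_one (add_smul_one_mul _ _ _) (add_smul_one_mul_sub _ _ _ _)
  rw [← add_smul_one_mul] at e₁ e₂
  have k₁ := h.add_mul_smul
  have k₂ := h.symm.add_mul_smul
  obtain rfl := eq_sub_of_add_eq h₁
  obtain rfl := eq_sub_of_add_eq h₂
  simp only [pow_succ, pow_zero, one_mul, mul_assoc]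
  rw [braid_sub_four h.symm.mul_mul_self h.mul_mul_self k₂ k₁]
  simp only [mul_sub (_ + _), k₁, k₂] at e₁ e₂
  have e := congrArg₂ (· - ·) e₁ e₂
  have e' : ∀ x y : B, x - q • y - q • y = x - 2 • q • y := fun x y => by module
  simp only [e'] at e
  rw [e]
  simp only [mul_add, h.twist₁, h.twist₂, mul_one, a2, a3, a4, b1, b2, b3]
  module

lemma braid_six (h : TwistedPair q σ₁ σ₂ c₁ c₆ Φ₁ Φ₂)
    (a2 : σ₁ c₂ = c₆) (a3 : σ₁ c₃ = c₅) (a4 : σ₁ c₄ = c₄) (a5 : σ₁ c₅ = c₃) (a6 : σ₁ c₆ = c₂)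
    (b1 : σ₂ c₁ = c₅) (b2 : σ₂ c₂ = c₄) (b3 : σ₂ c₃ = c₃) (b4 : σ₂ c₄ = c₂) (b5 : σ₂ c₅ = c₁)
    (r156 : RootRel q c₁ c₅ c₆) (r135 : RootRel q c₁ c₃ c₅) (r123 : RootRel q c₁ c₂ c₃)
    (r246 : RootRel q c₂ c₄ c₆) (r345 : RootRel q c₃ c₄ c₅)
    (h₁ : T₁ + 1 = Φ₁ + c₁ • 1) (h₂ : T₂ + 1 = Φ₂ + c₆ • 1) :
    (T₁ * T₂) ^ 3 - (T₂ * T₁) ^ 3 = (Φ₁ * Φ₂) ^ 3 - (Φ₂ * Φ₁) ^ 3 := by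
  have e₁ := h.expand_six_short a2 a3 a4 a5 a6 b1 b2 b3 b5 r156 r135 r123 r246 r345 _ _ _ _ _
    h.mul_add_smul_one (add_smul_one_mul _ _ _) (add_smul_one_mul_sub _ _ _ _)
    (add_smul_one_mul_sub _ _ _ _) (add_smul_one_mul_sub _ _ _ _)
  have e₂ := h.symm.expand_six_long b5 b4 b3 b2 b1 a6 a5 a4 a2 r156.symm r135.symm r123.symm
    r246.symm r345.symm _ _ _ _ _
    h.symm.mul_add_smul_one (add_smul_one_mul _ _ _) (add_smul_one_mul_sub _ _ _ _)
    (add_smul_one_mul_sub _ _ _ _) (add_smul_one_mul_sub _ _ _ _)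
  rw [← add_smul_one_mul] at e₁ e₂
  have k₁ := h.add_mul_smul
  have k₂ := h.symm.add_mul_smul
  obtain rfl := eq_sub_of_add_eq h₁
  obtain rfl := eq_sub_of_add_eq h₂
  simp only [pow_succ, pow_zero, one_mul, mul_assoc]
  rw [braid_sub_six h.symm.mul_mul_self h.mul_mul_self k₂ k₁]
  simp only [mul_sub (_ + _), k₁, k₂] at e₁ e₂
  have e := congrArg₂ (· - ·) e₁ e₂
  -- Collects the nested subtractions of the recursion into the coefficients 1, -4q, 3q² of
  -- `braid_sub_six`.
  have e' : ∀ x y z : B, x - q • y - q • y - q • (y - q • z) - q • (y - q • z - q • z) =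
      x - 4 • q • y + 3 • q • q • z := fun x y z => by module
  simp only [e'] at e
  rw [e]
  simp only [mul_add, h.twist₁, h.twist₂, mul_one, a2, a3, a4, a5, a6, b1, b2, b3, b4, b5]
  module

end TwistedPair

/-! ### Finiteness of the Weyl group -/

section WeylFinite

open Matrix

/-- Cauchy–Schwarz over ℤ, hence without division: the form is evaluated at ⟨w, w⟩u - ⟨u, w⟩w, and
the factor ⟨w, w⟩ > 0 is cancelled from the result. -/
lemma sq_dotProduct_mulVec_le {ι : Type*} [Fintype ι] {M : Matrix ι ι ℤ} (hM : M.PosDef)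
    (u w : ι → ℤ) : (u ⬝ᵥ M *ᵥ w) ^ 2 ≤ (u ⬝ᵥ M *ᵥ u) * (w ⬝ᵥ M *ᵥ w) := by
  rcases eq_or_ne w 0 with rfl | hw
  · simp
  have hsymm : w ⬝ᵥ M *ᵥ u = u ⬝ᵥ M *ᵥ w := by
    rw [dotProduct_mulVec, ← mulVec_transpose, dotProduct_comm]
    congr 2
    exact (conjTranspose_eq_transpose_of_trivial M).symm.trans hM.1
  have hpos : 0 < w ⬝ᵥ M *ᵥ w := hM.dotProduct_mulVec_pos hw
  have h := hM.posSemidef.dotProduct_mulVec_nonneg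
    ((w ⬝ᵥ M *ᵥ w) • u - (u ⬝ᵥ M *ᵥ w) • w)
  have hexp : star ((w ⬝ᵥ M *ᵥ w) • u - (u ⬝ᵥ M *ᵥ w) • w) ⬝ᵥ
      (M *ᵥ ((w ⬝ᵥ M *ᵥ w) • u - (u ⬝ᵥ M *ᵥ w) • w))
      = (w ⬝ᵥ M *ᵥ w) * ((u ⬝ᵥ M *ᵥ u) * (w ⬝ᵥ M *ᵥ w) - (u ⬝ᵥ M *ᵥ w) ^ 2) := by
    simp only [star_trivial, mulVec_sub, mulVec_smul, sub_dotProduct, dotProduct_sub,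
      smul_dotProduct, dotProduct_smul, smul_eq_mul, hsymm]
    ring
  rw [hexp] at h
  exact sub_nonneg.mp (nonneg_of_mul_nonneg_right h hpos)

/-- Each coordinate of w is, up to the nonzero factor det M, the pairing of w with a fixed vector,
so Cauchy–Schwarz bounds it. -/
lemma finite_setOf_dotProduct_mulVec_eq {ι : Type*} [Fintype ι] {M : Matrix ι ι ℤ}
    (hM : M.PosDef) (C : ℤ) : {w : ι → ℤ | w ⬝ᵥ M *ᵥ w = C}.Finite := by
  classical
  have hdet : M.det ≠ 0 := by
    intro h0
    obtain ⟨v, hv, hv0⟩ := exists_mulVec_eq_zero_iff.mpr h0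
    have := hM.dotProduct_mulVec_pos hv
    simp [hv0] at this
  set u : ι → ι → ℤ := fun i => M.adjugate *ᵥ Pi.single i 1
  set N : ι → ℤ := fun i => (u i ⬝ᵥ M *ᵥ u i) * C
  refine (Set.finite_Icc (-N) N).subset fun w hw => ?_
  have hw : w ⬝ᵥ M *ᵥ w = C := hw
  -- The columns `u i` of the adjugate satisfy ⟨w, u i⟩ = det M · w i. Being a nonzero integer, det
  -- M has square at least 1 and can be dropped from the bound.
  have hi (i : ι) : |w i| ≤ N i := by
    have h := sq_dotProduct_mulVec_le hM w (u i)
    have h1 : w ⬝ᵥ M *ᵥ u i = M.det * w i := by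
      simp only [u, mulVec_mulVec, mul_adjugate, smul_mulVec, one_mulVec, dotProduct_smul,
        dotProduct_single_one, smul_eq_mul]
    rw [h1, hw, mul_comm C] at h
    have h2 : w i ^ 2 ≤ N i := by
      refine le_trans ?_ h
      rw [mul_pow]
      have : 1 ≤ M.det ^ 2 := by have := sq_pos_of_ne_zero hdet; omega
      nlinarith [sq_nonneg (w i)]
    refine le_trans ?_ h2
    rw [← sq_abs]
    exact Int.le_self_sq _
  exact ⟨fun i => (abs_le.mp (hi i)).1, fun i => (abs_le.mp (hi i)).2⟩

variable {n : ℕ} (A : FiniteCartanMatrix n)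

/-- Finite type gives a form with the diagonal factor on the left, whereas the reflections read off
columns of the Cartan matrix. With e_r the product of the d_j for j ≠ r, congruence by diag(e) turns
diag(d)·a into (∏ d_j)·a·diag(e), which stays positive definite. -/
lemma FiniteCartanMatrix.exists_posDef_mul_diagonal :
    ∃ f : Fin n → ℤ, (A.a * diagonal f).PosDef := by
  classical
  obtain ⟨d, hd, hM⟩ := A.finite_type
  set e : Fin n → ℤ := fun r => ∏ j ∈ Finset.univ.erase r, d j
  have he (r : Fin n) : e r * d r = ∏ j, d j := Finset.prod_erase_mul _ _ (Finset.mem_univ r)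
  have hepos (r : Fin n) : 0 < e r := Finset.prod_pos fun j _ => hd j
  refine ⟨fun r => (∏ j, d j) * e r, ?_⟩
  have hinj : Function.Injective (diagonal e).mulVec := by
    intro v w hvw
    ext i
    have h := congrFun hvw i
    simp only [mulVec_diagonal] at h
    exact mul_left_cancel₀ (hepos i).ne' h
  have h := hM.conjTranspose_mul_mul_same hinj
  convert h using 1
  ext s r
  simp only [diagonal_conjTranspose, star_trivial, mul_diagonal, diagonal_mul, ← he s]
  ring

/-- Write the reflection as v - m e_r. Then ⟨v, e_r⟩ = m f_r and ⟨e_r, e_r⟩ = 2 f_r, so the two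
correction terms -2m²f_r and 2m²f_r cancel. -/
lemma FiniteCartanMatrix.latticeReflection_dotProduct {f : Fin n → ℤ}
    (hf : (A.a * diagonal f).PosDef) (r : Fin n) (v : Fin n → ℤ) :
    A.latticeReflection r v ⬝ᵥ (A.a * diagonal f) *ᵥ A.latticeReflection r v
      = v ⬝ᵥ (A.a * diagonal f) *ᵥ v := by
  classical
  set M := A.a * diagonal f with hMdef
  set m := ∑ s, v s * A.a s r
  have hv : A.latticeReflection r v = v - m • Pi.single r 1 := by
    change v - Pi.single r m = _
    rw [← Pi.single_smul, smul_eq_mul, mul_one]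
  have h1 : v ⬝ᵥ M *ᵥ Pi.single r 1 = m * f r := by
    simp only [dotProduct, mulVec_single_one, hMdef, m, Finset.sum_mul, col_apply, mul_diagonal]
    exact Finset.sum_congr rfl fun s _ => by ring
  have h2 : Pi.single r 1 ⬝ᵥ M *ᵥ v = m * f r := by
    rw [← h1, dotProduct_mulVec, ← mulVec_transpose, dotProduct_comm]
    congr 2
    exact (conjTranspose_eq_transpose_of_trivial M).symm.trans hf.1
  have h3 : Pi.single r 1 ⬝ᵥ M *ᵥ Pi.single r 1 = 2 * f r := by
    rw [single_one_dotProduct, mulVec_single_one, col_apply, hMdef, mul_diagonal, A.diag]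
  rw [hv]
  simp only [mulVec_sub, mulVec_smul, sub_dotProduct, dotProduct_sub,
      smul_dotProduct, dotProduct_smul, smul_eq_mul, h1, h2, h3]
  ring

/-- An isometry is determined by the images of the basis vectors, and each image lies in a finite
set of vectors of given norm. -/
lemma finite_isometries {M : Matrix (Fin n) (Fin n) ℤ} (hM : M.PosDef) :
    {g : (Fin n → ℤ) ≃+ (Fin n → ℤ) | ∀ v, g v ⬝ᵥ M *ᵥ g v = v ⬝ᵥ M *ᵥ v}.Finite := by
  classical
  refine Set.Finite.of_finite_image (f := fun g i => g (Pi.single i 1)) ?_ ?_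
  · refine (Set.Finite.pi' fun i => finite_setOf_dotProduct_mulVec_eq hM
      (Pi.single i 1 ⬝ᵥ M *ᵥ Pi.single i 1)).subset ?_
    rintro _ ⟨g, hg, rfl⟩ i
    exact hg _
  · intro g _ h _ hgh
    ext1 v
    have key : g.toAddMonoidHom = h.toAddMonoidHom := by
      refine AddMonoidHom.functions_ext' _ _ _ fun i => ?_
      ext
      exact congrFun (congrFun hgh i) _
    exact DFunLike.congr_fun key v

/-- Every element of the group is induced by an isometry of the lattice, by induction from the
simple reflections. -/
instance (k : Type*) [Field k] : Finite (weylGroup k A) := by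
  obtain ⟨f, hf⟩ := A.exists_posDef_mul_diagonal
  refine Set.Finite.to_subtype (Set.Finite.subset ((finite_isometries hf).image
    (AddMonoidAlgebra.domCongr k k)) fun w hw => ?_)
  induction hw using Subgroup.closure_induction with
  | mem x hx =>
    obtain ⟨r, rfl⟩ := hx
    exact ⟨A.latticeReflection r, A.latticeReflection_dotProduct hf r, rfl⟩
  | one => exact ⟨AddEquiv.refl _, fun v => rfl, AddMonoidAlgebra.domCongr_refl ..⟩
  | mul x y _ _ hx hy =>
    obtain ⟨g, hg, rfl⟩ := hx
    obtain ⟨h, hh, rfl⟩ := hy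
    refine ⟨h.trans g, fun v => (hg (h v)).trans (hh v), ?_⟩
    exact (AddMonoidAlgebra.trans_domCongr_domCongr ..).symm
  | inv x _ hx =>
    obtain ⟨g, hg, rfl⟩ := hx
    refine ⟨g.symm, fun v => ?_, rfl⟩
    have := hg (g.symm v)
    rw [g.apply_symm_apply] at this
    exact this.symm

/-- Every nonzero Laurent polynomial divides a nonzero invariant, namely its norm. -/
lemma exists_mul_mem_invariants {k : Type*} [Field k] (f : Laurent k n) (hf : f ≠ 0) :
    ∃ g : Laurent k n, f * g ∈ invariants k A ∧ f * g ≠ 0 := by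
  classical
  have := Fintype.ofFinite (weylGroup k A)
  -- The cofactor is the product of the conjugates of f by all w ≠ 1; multiplying by f gives the
  -- full norm, whose factors each group element permutes.
  refine ⟨∏ w ∈ Finset.univ.erase (1 : weylGroup k A), (w : Laurent k n ≃ₐ[k] Laurent k n) f, ?_⟩
  have h : f * ∏ w ∈ Finset.univ.erase (1 : weylGroup k A),
      (w : Laurent k n ≃ₐ[k] Laurent k n) f
      = ∏ w : weylGroup k A, (w : Laurent k n ≃ₐ[k] Laurent k n) f :=
    Finset.mul_prod_erase Finset.univ
      (fun w : weylGroup k A => (w : Laurent k n ≃ₐ[k] Laurent k n) f) (Finset.mem_univ 1)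
  rw [h]
  constructor
  · intro w hw
    rw [map_prod]
    exact Fintype.prod_equiv (Equiv.mulLeft (⟨w, hw⟩ : weylGroup k A)) _ _ fun x => rfl
  · rw [Finset.prod_ne_zero_iff]
    exact fun w _ => (map_ne_zero_iff _ (AlgEquiv.injective _)).mpr hf

end WeylFinite

/-! ### Rational functions in noncommutative algebras -/

section Fractions

/-- The extension of a homomorphism sending nonzero elements to units to the fraction field, for a
possibly noncommutative target. -/
def fracLift {k R B : Type*} [CommRing k] [CommRing R] [IsDomain R] [Ring B] [Algebra k R]
    [Algebra k B] (φ : R →ₐ[k] B) (h : ∀ f, f ≠ 0 → IsUnit (φ f)) : FractionRing R →ₐ[k] B where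
  -- The universal property of Ore localization permits a noncommutative target.
  __ := OreLocalization.universalHom (S := nonZeroDivisors R) φ.toRingHom
    (IsUnit.liftRight ((φ : R →* B).comp (nonZeroDivisors R).subtype)
      fun s => h s (nonZeroDivisors.coe_ne_zero s)) fun _ => rfl
  commutes' c := by
    have := OreLocalization.universalHom_commutes (S := nonZeroDivisors R) φ.toRingHom
      (IsUnit.liftRight ((φ : R →* B).comp (nonZeroDivisors R).subtype)
        fun s => h s (nonZeroDivisors.coe_ne_zero s)) (fun _ => rfl) (r := algebraMap k R c)
    exact this.trans (φ.commutes c)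

lemma fracLift_algebraMap {k R B : Type*} [CommRing k] [CommRing R] [IsDomain R] [Ring B]
    [Algebra k R] [Algebra k B] (φ : R →ₐ[k] B) (h : ∀ f, f ≠ 0 → IsUnit (φ f)) (f : R) :
    fracLift φ h (algebraMap R (FractionRing R) f) = φ f :=
  OreLocalization.universalHom_commutes (S := nonZeroDivisors R) φ.toRingHom _ (fun _ => rfl)

lemma ringInverse_map {K B : Type*} [Field K] [Ring B] (ι : K →+* B) {f : K} (hf : f ≠ 0) :
    Ring.inverse (ι f) = ι f⁻¹ :=
  Ring.inverse_unit ⟨ι f, ι f⁻¹, by rw [← map_mul, mul_inv_cancel₀ hf, map_one],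
    by rw [← map_mul, inv_mul_cancel₀ hf, map_one]⟩

end Fractions

/-! ### The field k(X₁, …, Xₙ), its reflections, and the functions (q - X^v)/(1 - X^v). -/

section LaurentFractions

variable (k : Type*) [Field k] {n : ℕ}

/-- The field of rational functions `k(X₁, …, Xₙ)`. -/
abbrev LaurentFrac (k : Type*) [Field k] (n : ℕ) := FractionRing (Laurent k n)

/-- The Laurent monomial `X^v` as a rational function. -/
def mon (v : Fin n → ℤ) : LaurentFrac k n :=
  algebraMap (Laurent k n) _ (AddMonoidAlgebra.single v 1)

lemma mon_add (v w : Fin n → ℤ) : mon k (v + w) = mon k v * mon k w := by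
  rw [mon, mon, mon, ← map_mul, AddMonoidAlgebra.single_mul_single, one_mul]

lemma mon_zero : mon k (0 : Fin n → ℤ) = 1 := by
  rw [mon, ← AddMonoidAlgebra.one_def, map_one]

lemma mon_ne_zero (v : Fin n → ℤ) : mon k v ≠ 0 := by
  intro h
  have := mon_add k v (-v)
  rw [h, zero_mul, add_neg_cancel, mon_zero] at this
  exact one_ne_zero this

lemma mon_neg (v : Fin n → ℤ) : mon k (-v) = (mon k v)⁻¹ := by
  refine eq_inv_of_mul_eq_one_left ?_
  rw [← mon_add, neg_add_cancel, mon_zero]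

lemma mon_zsmul (m : ℤ) (v : Fin n → ℤ) : mon k (m • v) = mon k v ^ m := by
  have h (p : ℕ) : mon k (p • v) = mon k v ^ p := by
    induction p with
    | zero => rw [zero_smul, mon_zero, pow_zero]
    | succ p ih => rw [succ_nsmul, mon_add, ih, pow_succ]
  obtain ⟨p, rfl | rfl⟩ := m.eq_nat_or_neg
  · rw [natCast_zsmul, h, zpow_natCast]
  · rw [neg_smul, mon_neg, natCast_zsmul, h, zpow_neg, zpow_natCast]

lemma one_sub_mon_ne_zero {v : Fin n → ℤ} (hv : v ≠ 0) : 1 - mon k v ≠ 0 := by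
  rw [← mon_zero k (n := n), mon, mon, ← map_sub]
  refine (map_ne_zero_iff _ (IsFractionRing.injective (Laurent k n) _)).mpr fun h => ?_
  have h2 := congrArg (fun f => f.coeff 0) (sub_eq_zero.mp h)
  simp [hv] at h2

lemma algebraMap_lX (r : Fin n) :
    algebraMap (Laurent k n) (LaurentFrac k n) (lX k r) = mon k (Pi.single r 1) := rfl

variable {k}

/-- A subalgebra of Laurent polynomials which contains the variables and is closed under inverting
monomials is everything. -/
lemma mem_subalgebra_of_lX (S : Subalgebra k (Laurent k n)) (hX : ∀ r, lX k r ∈ S)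
    (hinv : ∀ v : Fin n → ℤ, AddMonoidAlgebra.single v 1 ∈ S → AddMonoidAlgebra.single (-v) 1 ∈ S)
    (f : Laurent k n) : f ∈ S := by
  let G : AddSubgroup (Fin n → ℤ) :=
    { carrier := {v | (AddMonoidAlgebra.single v 1 : Laurent k n) ∈ S}
      zero_mem' := by
        change AddMonoidAlgebra.single 0 1 ∈ S
        rw [← AddMonoidAlgebra.one_def]
        exact one_mem _
      add_mem' := fun {v w} hv hw => by
        have h := mul_mem (S := Subalgebra k (Laurent k n)) hv hw
        rwa [AddMonoidAlgebra.single_mul_single, one_mul] at h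
      neg_mem' := fun {v} hv => hinv v hv }
  have hG (v : Fin n → ℤ) : v ∈ G := by
    rw [← Finset.univ_sum_single v]
    refine sum_mem fun i _ => ?_
    have h : (Pi.single i (v i) : Fin n → ℤ) = v i • Pi.single i 1 := by
      rw [← Pi.single_smul, smul_eq_mul, mul_one]
    rw [h]
    exact zsmul_mem (K := G) (hX i) _
  induction f using AddMonoidAlgebra.induction_linear with
  | zero => exact zero_mem _
  | add f g hf hg => exact add_mem hf hg
  | single v c =>
    have h : (AddMonoidAlgebra.single v c : Laurent k n) = c • AddMonoidAlgebra.single v 1 := by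
      rw [AddMonoidAlgebra.smul_single, smul_eq_mul, mul_one]
    rw [h]
    exact Subalgebra.smul_mem _ (hG v) c

lemma single_mul_single_neg (v : Fin n → ℤ) :
    (AddMonoidAlgebra.single v 1 * AddMonoidAlgebra.single (-v) 1 : Laurent k n) = 1 := by
  rw [AddMonoidAlgebra.single_mul_single, one_mul, add_neg_cancel, AddMonoidAlgebra.one_def]

/-- Two-sided inverses are unique in any ring, so agreement on the variables forces agreement on the
negative monomials too. -/
lemma laurent_algHom_ext {B : Type*} [Ring B] [Algebra k B] {φ ψ : Laurent k n →ₐ[k] B}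
    (h : ∀ r, φ (lX k r) = ψ (lX k r)) : φ = ψ := by
  refine AlgHom.ext fun f => ?_
  refine mem_subalgebra_of_lX (AlgHom.equalizer φ ψ) h (fun v hv => ?_) f
  have hv : φ (AddMonoidAlgebra.single v 1) = ψ (AddMonoidAlgebra.single v 1) := hv
  change φ (AddMonoidAlgebra.single (-v) 1) = ψ (AddMonoidAlgebra.single (-v) 1)
  refine left_inv_eq_right_inv (a := φ (AddMonoidAlgebra.single v 1)) ?_ ?_
  · rw [← map_mul, mul_comm, single_mul_single_neg, map_one]
  · rw [hv, ← map_mul, single_mul_single_neg, map_one]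

lemma laurentFrac_algHom_ext {B : Type*} [Ring B] [Algebra k B] {φ ψ : LaurentFrac k n →ₐ[k] B}
    (h : ∀ r, φ (mon k (Pi.single r 1)) = ψ (mon k (Pi.single r 1))) : φ = ψ := by
  have h1 : φ.comp (Algebra.ofId (Laurent k n) (LaurentFrac k n) |>.restrictScalars k)
      = ψ.comp (Algebra.ofId (Laurent k n) (LaurentFrac k n) |>.restrictScalars k) :=
    laurent_algHom_ext h
  refine AlgHom.coe_ringHom_injective
    (IsLocalization.ringHom_ext (nonZeroDivisors (Laurent k n)) (RingHom.ext fun f => ?_))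
  exact DFunLike.congr_fun h1 f

variable (k) (A : FiniteCartanMatrix n)

/-- The simple reflection `σ_r` on rational functions. -/
def fracReflection (r : Fin n) : LaurentFrac k n →+* LaurentFrac k n :=
  IsFractionRing.map (j := (simpleReflection k A r).toRingEquiv.toRingHom)
    (simpleReflection k A r).injective

lemma fracReflection_algebraMap (r : Fin n) (f : Laurent k n) :
    fracReflection k A r (algebraMap _ _ f) = algebraMap _ _ (simpleReflection k A r f) := by
  unfold fracReflection IsFractionRing.map
  exact IsLocalization.map_eq _ f

lemma fracReflection_const (r : Fin n) (c : k) :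
    fracReflection k A r (algebraMap k _ c) = algebraMap k _ c := by
  rw [IsScalarTower.algebraMap_apply k (Laurent k n) (LaurentFrac k n), fracReflection_algebraMap,
    AlgEquiv.commutes]

lemma fracReflection_mon (r : Fin n) (v : Fin n → ℤ) :
    fracReflection k A r (mon k v) = mon k (A.latticeReflection r v) := by
  rw [mon, fracReflection_algebraMap, simpleReflection, AddMonoidAlgebra.domCongr_single, mon]

lemma latticeReflection_single (r s : Fin n) :
    A.latticeReflection r (Pi.single s 1) = Pi.single s 1 - A.a s r • Pi.single r 1 := by
  change Pi.single s 1 - Pi.single r (∑ t, (Pi.single s 1 : Fin n → ℤ) t * A.a t r) =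
    (Pi.single s 1 - A.a s r • Pi.single r 1 : Fin n → ℤ)
  rw [← Pi.single_smul, smul_eq_mul, mul_one]
  congr 2
  simp [Pi.single_apply]

/-- The rational function `(q - X^v) / (1 - X^v)`. -/
def cFun (q : k) (v : Fin n → ℤ) : LaurentFrac k n :=
  (algebraMap k _ q - mon k v) / (1 - mon k v)

variable {k} (q : k)

lemma fracReflection_cFun (r : Fin n) (v : Fin n → ℤ) :
    fracReflection k A r (cFun k q v) = cFun k q (A.latticeReflection r v) := by
  simp only [cFun, map_div₀, map_sub, map_one, fracReflection_const, fracReflection_mon]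

/-- Since σ_r negates the r-th simple root, this is what makes σ_r(c_r) = 1 + q - c_r. -/
lemma cFun_neg {v : Fin n → ℤ} (hv : v ≠ 0) :
    cFun k q (-v) = 1 + algebraMap k _ q - cFun k q v := by
  have h1 := one_sub_mon_ne_zero k hv
  have h2 := one_sub_mon_ne_zero k (neg_ne_zero.mpr hv)
  have h3 := mon_ne_zero k v
  rw [mon_neg] at h2
  have h4 : mon k v - 1 ≠ 0 := fun h => h1 (by linear_combination -h)
  simp only [cFun, mon_neg]
  field_simp
  ring

/-- A rational identity in X^v and X^w, checked by clearing denominators; the braid computations use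
the additive structure of the roots only through it. -/
lemma rootRel_cFun {v w : Fin n → ℤ} (hv : v ≠ 0) (hw : w ≠ 0) (hvw : v + w ≠ 0) :
    RootRel (algebraMap k (LaurentFrac k n) q) (cFun k q v) (cFun k q (v + w)) (cFun k q w) := by
  have h1 := one_sub_mon_ne_zero k hv
  have h2 := one_sub_mon_ne_zero k hw
  have h3 := one_sub_mon_ne_zero k hvw
  rw [mon_add] at h3
  simp only [RootRel, cFun, mon_add]
  field_simp
  ring

end LaurentFractions

/-! ### Intertwiners and Hecke generators in an algebra containing rational functions -/

section Systems

variable {k : Type*} [Field k] {n : ℕ} (A : FiniteCartanMatrix n) (q : k)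
variable {B : Type*} [Ring B] [Algebra k B] (ι : LaurentFrac k n →ₐ[k] B)

variable {A} in
/-- An element which twists the variables by `σ_r` twists all rational functions by `σ_r`. -/
lemma twist_of_twist_lX {r : Fin n} {Φ : B}
    (h : ∀ s, Φ * ι (mon k (Pi.single s 1)) = ι (fracReflection k A r (mon k (Pi.single s 1))) * Φ)
    (f : LaurentFrac k n) : Φ * ι f = ι (fracReflection k A r f) * Φ := by
  let S : Subalgebra k (LaurentFrac k n) :=
    { carrier := {f | Φ * ι f = ι (fracReflection k A r f) * Φ}
      mul_mem' := fun {f g} hf hg => by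
        change Φ * ι (f * g) = ι (fracReflection k A r (f * g)) * Φ
        have hf : Φ * ι f = _ := hf
        have hg : Φ * ι g = _ := hg
        rw [map_mul, ← mul_assoc, hf, mul_assoc, hg, ← mul_assoc, ← map_mul, ← map_mul]
      add_mem' := fun {f g} hf hg => by
        change Φ * ι (f + g) = ι (fracReflection k A r (f + g)) * Φ
        have hf : Φ * ι f = _ := hf
        have hg : Φ * ι g = _ := hg
        rw [map_add, mul_add, hf, hg, map_add, map_add, add_mul]
      algebraMap_mem' := fun c => by
        change Φ * ι (algebraMap k _ c) = ι (fracReflection k A r (algebraMap k _ c)) * Φ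
        rw [fracReflection_const, AlgHom.commutes, Algebra.commutes] }
  have hinv (f : LaurentFrac k n) (hf : f ∈ S) : f⁻¹ ∈ S := by
    rcases eq_or_ne f 0 with rfl | hf0
    · rwa [inv_zero]
    have hf : Φ * ι f = ι (fracReflection k A r f) * Φ := hf
    change Φ * ι f⁻¹ = ι (fracReflection k A r f⁻¹) * Φ
    have h1 : ι (fracReflection k A r f⁻¹) * ι (fracReflection k A r f) = 1 := by
      rw [← map_mul, ← map_mul, inv_mul_cancel₀ hf0, map_one, map_one]
    have h2 : ι f * ι f⁻¹ = 1 := by rw [← map_mul, mul_inv_cancel₀ hf0, map_one]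
    calc Φ * ι f⁻¹ = ι (fracReflection k A r f⁻¹) * (ι (fracReflection k A r f) * Φ) * ι f⁻¹ := by
          rw [← mul_assoc, h1, one_mul]
      _ = _ := by rw [← hf, mul_assoc, mul_assoc, h2, mul_one]
  have hL (f : Laurent k n) : algebraMap _ _ f ∈ S := by
    refine mem_subalgebra_of_lX (S.comap (Algebra.ofId (Laurent k n) (LaurentFrac k n)
      |>.restrictScalars k)) h (fun v hv => ?_) f
    change mon k (-v) ∈ S
    rw [mon_neg]
    exact hinv _ hv
  obtain ⟨a, b, -, rfl⟩ := IsFractionRing.div_surjective (Laurent k n) f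
  rw [div_eq_mul_inv]
  exact mul_mem (hL a) (hinv _ (hL b))

/-- Elements satisfying the one-variable relations of the intertwiners. -/
structure IntertwinerSystem (Φ : Fin n → B) : Prop where
  twist : ∀ r f, Φ r * ι f = ι (fracReflection k A r f) * Φ r
  square : ∀ r, Φ r * Φ r = ι (cFun k q (Pi.single r 1) *
    (1 + algebraMap k _ q - cFun k q (Pi.single r 1)))

/-- The Hecke generator attached to an intertwiner. -/
def heckeOf (Φ : Fin n → B) (r : Fin n) : B := Φ r + ι (cFun k q (Pi.single r 1)) - 1

lemma single_ne_zero (r : Fin n) : (Pi.single r 1 : Fin n → ℤ) ≠ 0 := by simp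

variable {A ι} in
-- Moving c_r past Φ_r replaces it by 1 + q - c_r, and the terms linear in Φ_r cancel. As an
-- equality of defects, it serves to pass from Φ_r to T_r and back.
lemma quadratic_heckeOf {Φ : Fin n → B} {r : Fin n}
    (h : ∀ f, Φ r * ι f = ι (fracReflection k A r f) * Φ r) :
    (heckeOf q ι Φ r + 1) * (heckeOf q ι Φ r - algebraMap k B q) =
      Φ r * Φ r - ι (cFun k q (Pi.single r 1) *
        (1 + algebraMap k _ q - cFun k q (Pi.single r 1))) := by
  have hrefl : fracReflection k A r (cFun k q (Pi.single r 1)) =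
      1 + algebraMap k _ q - cFun k q (Pi.single r 1) := by
    rw [fracReflection_cFun, latticeReflection_single, A.diag, ← cFun_neg q (single_ne_zero r)]
    congr 1
    module
  unfold heckeOf
  set c := cFun k q (Pi.single r (1 : ℤ))
  have hc := h c
  rw [hrefl, map_sub, map_add, map_one, AlgHom.commutes] at hc
  have hq : Φ r * algebraMap k B q = algebraMap k B q * Φ r := (Algebra.commutes q (Φ r)).symm
  have hq' : ι c * algebraMap k B q = algebraMap k B q * ι c := (Algebra.commutes q _).symm
  simp only [map_mul, map_add, map_sub, map_one, AlgHom.commutes]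
  rw [sub_add_cancel, sub_sub, mul_sub, mul_add, add_mul, add_mul, hc]
  simp only [mul_add, add_mul, mul_sub, sub_mul, hq, hq', mul_one, one_mul]
  abel

variable {A ι} in
-- The terms without Φ_r vanish because c_r - 1 = -(1 - q)/(1 - X_r), so (c_r - 1)(f - σ_r(f)) = (1
-- - q) D_r(f). Nothing is assumed about Φ_r, so each of the two commutation rules implies the
-- other.
lemma heckeOf_mul_sub {Φ : Fin n → B} {r : Fin n} (f : Laurent k n) :
    heckeOf q ι Φ r * ι (algebraMap _ _ f)
        - (ι (algebraMap _ _ (simpleReflection k A r f)) * heckeOf q ι Φ r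
          + (1 - q) • ι (algebraMap _ _ (demazure A r f))) =
      Φ r * ι (algebraMap _ _ f) - ι (fracReflection k A r (algebraMap _ _ f)) * Φ r := by
  have h1 := one_sub_mon_ne_zero k (single_ne_zero r)
  have hD := congrArg (algebraMap (Laurent k n) (LaurentFrac k n)) (demazure_spec A r f)
  rw [map_mul, map_sub, map_sub, map_one, algebraMap_lX] at hD
  rw [fracReflection_algebraMap]
  set g := algebraMap (Laurent k n) (LaurentFrac k n) f
  set g' := algebraMap (Laurent k n) (LaurentFrac k n) (simpleReflection k A r f)
  set d := algebraMap (Laurent k n) (LaurentFrac k n) (demazure A r f)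
  have key : cFun k q (Pi.single r 1) * g - g - (g' * cFun k q (Pi.single r 1) - g')
      - (1 - q) • d = 0 := by
    have hd : d = (g' - g) / (1 - mon k (Pi.single r 1)) := by
      rw [eq_div_iff h1, mul_comm, hD]
    rw [Algebra.smul_def, map_sub, map_one, hd, cFun]
    field_simp
    ring
  have key' := congrArg ι key
  simp only [map_sub, map_mul, map_smul, map_zero] at key'
  simp only [heckeOf, sub_mul, add_mul, mul_sub, mul_add, one_mul, mul_one]
  rw [← sub_eq_zero, ← key']
  abel

variable {A q ι} {Φ : Fin n → B}

/-- The positive roots of rank two. -/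
def rankTwoRoot (r s : Fin n) (a b : ℤ) : Fin n → ℤ := a • Pi.single r 1 + b • Pi.single s 1

lemma rankTwoRoot_ne_zero {r s : Fin n} (hrs : r ≠ s) {a b : ℤ} (h : a ≠ 0 ∨ b ≠ 0) :
    rankTwoRoot r s a b ≠ 0 := by
  intro h0
  have h1 := congrFun h0 r
  have h2 := congrFun h0 s
  simp [rankTwoRoot, hrs, hrs.symm] at h1 h2
  tauto

lemma reflection_left_rankTwoRoot (r s : Fin n) (a b c : ℤ) (h : A.a s r = c) :
    A.latticeReflection r (rankTwoRoot r s a b) = rankTwoRoot r s (-a - b * c) b := by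
  rw [rankTwoRoot, map_add, map_zsmul, map_zsmul, latticeReflection_single,
    latticeReflection_single, A.diag, h, rankTwoRoot]
  module

lemma reflection_right_rankTwoRoot (r s : Fin n) (a b c : ℤ) (h : A.a r s = c) :
    A.latticeReflection s (rankTwoRoot r s a b) = rankTwoRoot r s a (-b - a * c) := by
  rw [rankTwoRoot, map_add, map_zsmul, map_zsmul, latticeReflection_single,
    latticeReflection_single, A.diag, h, rankTwoRoot]
  module

lemma rootRel_rankTwoRoot (q : k) {r s : Fin n} (hrs : r ≠ s) {a b a' b' a'' b'' : ℤ}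
    (h : a ≠ 0 ∨ b ≠ 0) (h' : a' ≠ 0 ∨ b' ≠ 0) (h'' : a'' ≠ 0 ∨ b'' ≠ 0)
    (ha : a' = a + a'') (hb : b' = b + b'') :
    RootRel (algebraMap k (LaurentFrac k n) q) (cFun k q (rankTwoRoot r s a b))
      (cFun k q (rankTwoRoot r s a' b')) (cFun k q (rankTwoRoot r s a'' b'')) := by
  have e : rankTwoRoot r s a' b' = rankTwoRoot r s a b + rankTwoRoot r s a'' b'' := by
    subst ha hb
    simp only [rankTwoRoot]
    module
  have h0 := rankTwoRoot_ne_zero hrs h'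
  rw [e] at h0 ⊢
  exact rootRel_cFun q (rankTwoRoot_ne_zero hrs h) (rankTwoRoot_ne_zero hrs h'') h0

lemma rankTwoRoot_one_zero (r s : Fin n) : rankTwoRoot r s 1 0 = Pi.single r 1 := by
  simp [rankTwoRoot]

lemma rankTwoRoot_zero_one (r s : Fin n) : rankTwoRoot r s 0 1 = Pi.single s 1 := by
  simp [rankTwoRoot]

namespace IntertwinerSystem

/-- The action of rational functions by left multiplication. -/
abbrev leftModule (ι : LaurentFrac k n →ₐ[k] B) : Module (LaurentFrac k n) B :=
  Module.compHom B ι.toRingHom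

/-- Rational functions are not central in `B`, so they act by left multiplication only: a module
structure, not an algebra structure. -/
lemma twistedPair (h : IntertwinerSystem A q ι Φ) (r s : Fin n) :
    letI := leftModule ι
    TwistedPair (algebraMap k (LaurentFrac k n) q) (fracReflection k A r) (fracReflection k A s)
      (cFun k q (rankTwoRoot r s 1 0)) (cFun k q (rankTwoRoot r s 0 1)) (Φ r) (Φ s) := by
  let := leftModule ι
  have hsmul (f : LaurentFrac k n) (x : B) : f • x = ι f * x := rfl
  have hrefl (t : Fin n) : fracReflection k A t (cFun k q (Pi.single t 1)) =
      1 + algebraMap k _ q - cFun k q (Pi.single t 1) := by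
    rw [fracReflection_cFun, latticeReflection_single, A.diag, ← cFun_neg q (single_ne_zero t)]
    congr 1
    module
  rw [rankTwoRoot_one_zero, rankTwoRoot_zero_one]
  refine ⟨fracReflection_const .., fracReflection_const .., hrefl r, hrefl s, ?_, ?_, ?_, ?_⟩
  all_goals
    intros
    simp only [hsmul, ← mul_assoc, h.twist, h.square]

lemma braid_noEdge (h : IntertwinerSystem A q ι Φ) {r s : Fin n} (e : A.NoEdge r s) :
    heckeOf q ι Φ r * heckeOf q ι Φ s - heckeOf q ι Φ s * heckeOf q ι Φ r =
      Φ r * Φ s - Φ s * Φ r := by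
  let := leftModule ι
  have : IsScalarTower (LaurentFrac k n) B B := ⟨fun _ _ _ => mul_assoc _ _ _⟩
  have hs : ∀ f : LaurentFrac k n, f • (1 : B) = ι f := fun f => mul_one _
  refine (h.twistedPair r s).braid_two ?_ ?_ ?_ ?_
  · rw [fracReflection_cFun, reflection_left_rankTwoRoot _ _ _ _ _ e.2]; norm_num
  · rw [fracReflection_cFun, reflection_right_rankTwoRoot _ _ _ _ _ e.1]; norm_num
  · rw [heckeOf, sub_add_cancel, hs, rankTwoRoot_one_zero]
  · rw [heckeOf, sub_add_cancel, hs, rankTwoRoot_zero_one]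

lemma braid_singleEdge (h : IntertwinerSystem A q ι Φ) {r s : Fin n} (e : A.SingleEdge r s) :
    heckeOf q ι Φ r * heckeOf q ι Φ s * heckeOf q ι Φ r
        - heckeOf q ι Φ s * heckeOf q ι Φ r * heckeOf q ι Φ s =
      Φ r * Φ s * Φ r - Φ s * Φ r * Φ s := by
  let := leftModule ι
  have : IsScalarTower (LaurentFrac k n) B B := ⟨fun _ _ _ => mul_assoc _ _ _⟩
  have hs : ∀ f : LaurentFrac k n, f • (1 : B) = ι f := fun f => mul_one _
  have hrs : r ≠ s := by
    rintro rfl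
    have := A.diag r
    have := e.1
    omega
  refine (h.twistedPair r s).braid_three (c₂ := cFun k q (rankTwoRoot r s 1 1))
    ?_ ?_ ?_ ?_ ?_ ?_ ?_
  · rw [fracReflection_cFun, reflection_left_rankTwoRoot _ _ _ _ _ e.2]; norm_num
  · rw [fracReflection_cFun, reflection_left_rankTwoRoot _ _ _ _ _ e.2]; norm_num
  · rw [fracReflection_cFun, reflection_right_rankTwoRoot _ _ _ _ _ e.1]; norm_num
  · rw [fracReflection_cFun, reflection_right_rankTwoRoot _ _ _ _ _ e.1]; norm_num
  · apply rootRel_rankTwoRoot q hrs <;> norm_num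
  · rw [heckeOf, sub_add_cancel, hs, rankTwoRoot_one_zero]
  · rw [heckeOf, sub_add_cancel, hs, rankTwoRoot_zero_one]

/-- The arrow points to the short root s, and the rank two computation wants the short root first;
hence the order s, r on both sides. -/
lemma braid_doubleEdge (h : IntertwinerSystem A q ι Φ) {r s : Fin n} (e : A.DoubleEdge r s) :
    (heckeOf q ι Φ s * heckeOf q ι Φ r) ^ 2 - (heckeOf q ι Φ r * heckeOf q ι Φ s) ^ 2 =
      (Φ s * Φ r) ^ 2 - (Φ r * Φ s) ^ 2 := by
  let := leftModule ι
  have : IsScalarTower (LaurentFrac k n) B B := ⟨fun _ _ _ => mul_assoc _ _ _⟩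
  have hs : ∀ f : LaurentFrac k n, f • (1 : B) = ι f := fun f => mul_one _
  have hrs : s ≠ r := by
    rintro rfl
    have := A.diag s
    have := e.1
    omega
  refine (h.twistedPair s r).braid_four (c₂ := cFun k q (rankTwoRoot s r 2 1))
    (c₃ := cFun k q (rankTwoRoot s r 1 1)) ?_ ?_ ?_ ?_ ?_ ?_ ?_ ?_ ?_ ?_
  iterate 3
    rw [fracReflection_cFun, reflection_left_rankTwoRoot _ _ _ _ _ e.1]; norm_num
  iterate 3
    rw [fracReflection_cFun, reflection_right_rankTwoRoot _ _ _ _ _ e.2]; norm_num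
  iterate 2
    apply rootRel_rankTwoRoot q hrs <;> norm_num
  · rw [heckeOf, sub_add_cancel, hs, rankTwoRoot_one_zero]
  · rw [heckeOf, sub_add_cancel, hs, rankTwoRoot_zero_one]

/-- As for the double edge, the short root s comes first; the witnesses are the four nonsimple
positive roots of G₂ between s and r. -/
lemma braid_tripleEdge (h : IntertwinerSystem A q ι Φ) {r s : Fin n} (e : A.TripleEdge r s) :
    (heckeOf q ι Φ s * heckeOf q ι Φ r) ^ 3 - (heckeOf q ι Φ r * heckeOf q ι Φ s) ^ 3 =
      (Φ s * Φ r) ^ 3 - (Φ r * Φ s) ^ 3 := by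
  let := leftModule ι
  have : IsScalarTower (LaurentFrac k n) B B := ⟨fun _ _ _ => mul_assoc _ _ _⟩
  have hs : ∀ f : LaurentFrac k n, f • (1 : B) = ι f := fun f => mul_one _
  have hrs : s ≠ r := by
    rintro rfl
    have := A.diag s
    have := e.1
    omega
  refine (h.twistedPair s r).braid_six (c₂ := cFun k q (rankTwoRoot s r 3 1))
    (c₃ := cFun k q (rankTwoRoot s r 2 1)) (c₄ := cFun k q (rankTwoRoot s r 3 2))
    (c₅ := cFun k q (rankTwoRoot s r 1 1)) ?_ ?_ ?_ ?_ ?_ ?_ ?_ ?_ ?_ ?_ ?_ ?_ ?_ ?_ ?_ ?_ ?_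
  iterate 5
    rw [fracReflection_cFun, reflection_left_rankTwoRoot _ _ _ _ _ e.1]; norm_num
  iterate 5
    rw [fracReflection_cFun, reflection_right_rankTwoRoot _ _ _ _ _ e.2]; norm_num
  iterate 5
    apply rootRel_rankTwoRoot q hrs <;> norm_num
  · rw [heckeOf, sub_add_cancel, hs, rankTwoRoot_one_zero]
  · rw [heckeOf, sub_add_cancel, hs, rankTwoRoot_zero_one]

end IntertwinerSystem

end Systems

/-! ### Homomorphisms out of the two presented algebras -/

section Homs

variable {k : Type*} [Field k] {n : ℕ} {A : FiniteCartanMatrix n} {q : k}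
variable {B : Type*} [Ring B] [Algebra k B]

variable (A) in
/-- The braid relations of a Dynkin diagram. -/
structure BraidRelations (x : Fin n → B) : Prop where
  noEdge : ∀ r s, A.NoEdge r s → x r * x s = x s * x r
  singleEdge : ∀ r s, A.SingleEdge r s → x r * x s * x r = x s * x r * x s
  doubleEdge : ∀ r s, A.DoubleEdge r s → (x r * x s) ^ 2 = (x s * x r) ^ 2
  tripleEdge : ∀ r s, A.TripleEdge r s → (x r * x s) ^ 3 = (x s * x r) ^ 3

/-- Corresponding braid defects are equal, so they vanish together. One direction yields the map out
of the Hecke algebra, the other the map out of the presented algebra. -/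
lemma IntertwinerSystem.braidRelations_iff {ι : LaurentFrac k n →ₐ[k] B} {Φ : Fin n → B}
    (h : IntertwinerSystem A q ι Φ) :
    BraidRelations A (heckeOf q ι Φ) ↔ BraidRelations A Φ := by
  constructor
  · intro b
    refine ⟨fun r s e => ?_, fun r s e => ?_, fun r s e => ?_, fun r s e => ?_⟩
    · rw [← sub_eq_zero, ← h.braid_noEdge e, b.noEdge r s e, sub_self]
    · rw [← sub_eq_zero, ← h.braid_singleEdge e, b.singleEdge r s e, sub_self]
    · rw [eq_comm, ← sub_eq_zero, ← h.braid_doubleEdge e, b.doubleEdge r s e, sub_self]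
    · rw [eq_comm, ← sub_eq_zero, ← h.braid_tripleEdge e, b.tripleEdge r s e, sub_self]
  · intro b
    refine ⟨fun r s e => ?_, fun r s e => ?_, fun r s e => ?_, fun r s e => ?_⟩
    · rw [← sub_eq_zero, h.braid_noEdge e, b.noEdge r s e, sub_self]
    · rw [← sub_eq_zero, h.braid_singleEdge e, b.singleEdge r s e, sub_self]
    · rw [eq_comm, ← sub_eq_zero, h.braid_doubleEdge e, b.doubleEdge r s e, sub_self]
    · rw [eq_comm, ← sub_eq_zero, h.braid_tripleEdge e, b.tripleEdge r s e, sub_self]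

lemma mon_eq_prod (v : Fin n → ℤ) : mon k v = ∏ i, mon k (Pi.single i 1) ^ v i := by
  have h (s : Finset (Fin n)) :
      mon k (∑ i ∈ s, v i • Pi.single i 1) = ∏ i ∈ s, mon k (Pi.single i 1) ^ v i := by
    induction s using Finset.cons_induction with
    | empty => exact mon_zero k
    | cons a s ha ih => rw [Finset.sum_cons, Finset.prod_cons, mon_add, ih, mon_zsmul]
  rw [← h]
  congr 1
  ext j
  simp [Finset.sum_apply, Pi.single_apply]

lemma map_laurentEval {ι : LaurentFrac k n →ₐ[k] B} {g : FreeAlgebra k (HeckeGen n) →ₐ[k] B}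
    (hX : ∀ r, g (fX k r) = ι (mon k (Pi.single r 1)))
    (hXinv : ∀ r, g (fXinv k r) = ι (mon k (Pi.single r 1))⁻¹) (f : Laurent k n) :
    g (laurentEval (fX k) (fXinv k) f) = ι (algebraMap _ _ f) := by
  have hf : f = f.coeff.sum fun v c => c • AddMonoidAlgebra.single v 1 := by
    simp only [AddMonoidAlgebra.smul_single, smul_eq_mul, mul_one]
    exact (AddMonoidAlgebra.sum_coeff_single f).symm
  conv_rhs => rw [hf]
  rw [laurentEval, Finsupp.sum, Finsupp.sum, map_sum, map_sum, map_sum]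
  refine Finset.sum_congr rfl fun v _ => ?_
  have hs : algebraMap (Laurent k n) (LaurentFrac k n)
      (f.coeff v • AddMonoidAlgebra.single v 1) = f.coeff v • mon k v :=
    map_smul (IsScalarTower.toAlgHom k (Laurent k n) (LaurentFrac k n)) _ _
  rw [map_smul, hs, map_smul, mon_eq_prod, ← List.prod_ofFn, map_list_prod, map_list_prod,
    List.map_ofFn, List.map_ofFn]
  congr 3
  funext i
  simp only [Function.comp, map_mul, map_pow, hX, hXinv]
  rw [← map_pow, ← map_pow, ← map_mul]
  obtain ⟨p, h | h⟩ := (v i).eq_nat_or_neg <;> simp [h]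

lemma map_gPoly {φ : Laurent k n →ₐ[k] B} {g : FreeAlgebra k (IntertwinerGen k n) →ₐ[k] B}
    (hX : ∀ r, g (gX k r) = φ (lX k r)) (f : MvPolynomial (Fin n) k) :
    g (gPoly f) = φ (MvPolynomial.aeval (lX k) f) := by
  rw [gPoly, map_sum, MvPolynomial.aeval_def, MvPolynomial.eval₂_eq', map_sum]
  refine Finset.sum_congr rfl fun m _ => ?_
  rw [map_smul, map_mul, AlgHom.commutes, ← Algebra.smul_def, ← List.prod_ofFn, map_list_prod,
    map_list_prod, List.map_ofFn, List.map_ofFn]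
  congr 3
  funext i
  simp only [Function.comp, map_pow, hX]

lemma gPoly_X (r : Fin n) : gPoly (MvPolynomial.X r : MvPolynomial (Fin n) k) = gX k r := by
  rw [gPoly, MvPolynomial.support_X, Finset.sum_singleton, MvPolynomial.coeff_X, if_pos rfl,
    one_smul]
  have h : (fun i => gX k i ^ (Finsupp.single r 1 : Fin n →₀ ℕ) i)
      = fun i => if i = r then gX k r else 1 := by
    funext i
    by_cases h : i = r
    · subst h; simp
    · simp [h, Finsupp.single_apply, Ne.symm h]
  rw [h, prod_ofFn_ite]

/-- A homomorphism on the free algebra compatible with an embedding of rational functions. -/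
structure CompatibleEval (ι : LaurentFrac k n →ₐ[k] B)
    (g : FreeAlgebra k (IntertwinerGen k n) →ₐ[k] B) : Prop where
  X : ∀ r, g (gX k r) = ι (mon k (Pi.single r 1))
  inv : ∀ f hf, g (gInv f hf) = ι (algebraMap (Laurent k n) _ (MvPolynomial.aeval (lX k) f))⁻¹

namespace CompatibleEval

variable {ι : LaurentFrac k n →ₐ[k] B} {g : FreeAlgebra k (IntertwinerGen k n) →ₐ[k] B}

lemma map_gPoly (h : CompatibleEval ι g) (f : MvPolynomial (Fin n) k) :
    g (gPoly f) = ι (algebraMap (Laurent k n) _ (MvPolynomial.aeval (lX k) f)) :=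
  AffineHecke.map_gPoly (φ := ι.comp ((Algebra.ofId (Laurent k n) (LaurentFrac k n)).restrictScalars
    k)) h.X f

lemma map_gXpow (h : CompatibleEval ι g) (r : Fin n) (m : ℤ) :
    g (gXpow k r m) = ι (mon k (Pi.single r 1) ^ m) := by
  rw [gXpow, map_mul, map_pow, map_pow, h.X, h.inv, MvPolynomial.aeval_X, algebraMap_lX, ← map_pow,
    ← map_pow, ← map_mul]
  obtain ⟨p, rfl | rfl⟩ := m.eq_nat_or_neg <;> simp

lemma map_reflection (h : CompatibleEval ι g) (A : FiniteCartanMatrix n) (r s : Fin n) :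
    g (gX k s * gXpow k r (-A.a s r)) =
      ι (fracReflection k A r (mon k (Pi.single s 1))) := by
  rw [map_mul, h.X, h.map_gXpow, ← map_mul, fracReflection_mon, latticeReflection_single,
    sub_eq_add_neg, mon_add, ← neg_smul, mon_zsmul]

/-- The second factor is 1 + q - c_r = (1 - qX_r)/(1 - X_r). -/
lemma map_square (h : CompatibleEval ι g) (r : Fin n) :
    g ((1 - q • gX k r) * (algebraMap k _ q - gX k r)
        * gInv ((1 - MvPolynomial.X r) ^ 2) (one_sub_X_sq_ne_zero r)) =
      ι (cFun k q (Pi.single r 1) * (1 + algebraMap k _ q - cFun k q (Pi.single r 1))) := by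
  have h1 := one_sub_mon_ne_zero k (single_ne_zero r)
  have hc : cFun k q (Pi.single r 1) * (1 + algebraMap k _ q - cFun k q (Pi.single r 1)) =
      (1 - q • mon k (Pi.single r 1)) * (algebraMap k _ q - mon k (Pi.single r 1))
        * ((1 - mon k (Pi.single r 1)) ^ 2)⁻¹ := by
    rw [Algebra.smul_def, cFun]
    field_simp
    ring
  rw [hc]
  simp only [map_mul, map_sub, map_smul, map_one, AlgHom.commutes, h.X, h.inv, map_pow,
    MvPolynomial.aeval_X, algebraMap_lX]

end CompatibleEval

end Homs

/-! ### Polynomials inside Laurent polynomials. -/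

section MvPolynomials

variable {k : Type*} [Field k] {n : ℕ}

lemma prod_lX_pow (m : Fin n →₀ ℕ) :
    ∏ i, lX k i ^ m i = AddMonoidAlgebra.single (fun i => (m i : ℤ)) 1 := by
  apply IsFractionRing.injective (Laurent k n) (LaurentFrac k n)
  change _ = mon k _
  rw [mon_eq_prod]
  simp only [map_prod, map_pow, algebraMap_lX, zpow_natCast]

/-- Distinct monomials go to distinct Laurent monomials, so a nonzero coefficient of f survives. -/
lemma aeval_lX_ne_zero {f : MvPolynomial (Fin n) k} (hf : f ≠ 0) :
    (MvPolynomial.aeval (lX k) f : Laurent k n) ≠ 0 := by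
  obtain ⟨m, hm⟩ := MvPolynomial.ne_zero_iff.mp hf
  intro h
  refine hm ?_
  have h1 := congrArg (fun g => g.coeff fun i => (m i : ℤ)) h
  simp only [MvPolynomial.aeval_def, MvPolynomial.eval₂_eq', prod_lX_pow, ← Algebra.smul_def,
    AddMonoidAlgebra.smul_single, smul_eq_mul, mul_one] at h1
  rw [AddMonoidAlgebra.coeff_sum, Finsupp.finsetSum_apply, Finset.sum_eq_single m] at h1
  · simpa using h1
  · intro b _ hb
    rw [AddMonoidAlgebra.coeff_single, Finsupp.single_apply, if_neg]
    intro h2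
    exact hb (Finsupp.ext fun i => Nat.cast_injective (congrFun h2 i))
  · intro h2
    rw [MvPolynomial.notMem_support_iff.mp h2]
    simp

/-- Every Laurent polynomial becomes a polynomial after multiplication with a monomial. -/
lemma exists_mul_aeval_lX_eq (f : Laurent k n) : ∃ m p : MvPolynomial (Fin n) k,
    IsUnit (MvPolynomial.aeval (lX k) m : Laurent k n) ∧
      f * MvPolynomial.aeval (lX k) m = MvPolynomial.aeval (lX k) p := by
  let S : Subalgebra k (Laurent k n) :=
    { carrier := {f | ∃ m p : MvPolynomial (Fin n) k,
        IsUnit (MvPolynomial.aeval (lX k) m : Laurent k n) ∧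
          f * MvPolynomial.aeval (lX k) m = MvPolynomial.aeval (lX k) p}
      mul_mem' := by
        rintro f g ⟨m, p, hm, hp⟩ ⟨m', p', hm', hp'⟩
        refine ⟨m * m', p * p', by rw [map_mul]; exact hm.mul hm', ?_⟩
        rw [map_mul, map_mul, ← hp, ← hp']
        ring
      add_mem' := by
        rintro f g ⟨m, p, hm, hp⟩ ⟨m', p', hm', hp'⟩
        refine ⟨m * m', p * m' + p' * m, by rw [map_mul]; exact hm.mul hm', ?_⟩
        rw [map_mul, map_add, map_mul, map_mul, ← hp, ← hp']
        ring
      algebraMap_mem' := fun c => ⟨1, MvPolynomial.C c, by simp, by simp⟩ }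
  refine mem_subalgebra_of_lX S (fun r => ⟨1, MvPolynomial.X r, by simp, by simp⟩) ?_ f
  rintro v ⟨m, p, hm, hp⟩
  -- From X^v m = p follows X^{-v} p = m, so the witnesses trade places, and p becomes a unit
  -- because X^v and m are.
  refine ⟨p, m, ?_, ?_⟩
  · rw [← hp]
    exact (IsUnit.of_mul_eq_one _ (single_mul_single_neg v)).mul hm
  · rw [← hp, ← mul_assoc, mul_comm (AddMonoidAlgebra.single (-v) 1),
      single_mul_single_neg, one_mul]

end MvPolynomials

section LaurentLift

variable {k : Type*} [Field k] {n : ℕ} {B : Type*} [Ring B] [Algebra k B]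

/-- The homomorphism from Laurent polynomials given by commuting units. -/
def laurentLift (u : Fin n → Bˣ) (hu : ∀ r s, Commute (u r) (u s)) : Laurent k n →ₐ[k] B :=
  AddMonoidAlgebra.lift k B (Fin n → ℤ) ((Units.coeHom B).comp
    { toFun := fun v => (List.ofFn fun i => u i ^ (v.toAdd i)).prod
      map_one' := List.prod_eq_one fun x hx => by
        rw [List.mem_ofFn] at hx
        obtain ⟨i, rfl⟩ := hx
        simp
      map_mul' := fun v w => by
        rw [← prod_ofFn_mul _ _ fun i j => ((hu i j).zpow_zpow _ _)]
        simp only [toAdd_mul, Pi.add_apply, zpow_add] })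

lemma laurentLift_lX (u : Fin n → Bˣ) (hu : ∀ r s, Commute (u r) (u s)) (r : Fin n) :
    laurentLift (k := k) u hu (lX k r) = u r := by
  rw [laurentLift, lX, AddMonoidAlgebra.lift_single, one_smul]
  change (((List.ofFn fun i => u i ^ ((Pi.single r 1 : Fin n → ℤ) i)).prod : Bˣ) : B) = _
  have h : (fun i => u i ^ ((Pi.single r 1 : Fin n → ℤ) i))
      = fun i => if i = r then u r else 1 := by
    funext i
    by_cases h : i = r
    · subst h; simp
    · simp [h]
  rw [h, prod_ofFn_ite]

end LaurentLift

/-! ### Representations of both algebras obtained from an intertwiner system. -/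

section UniversalProperties

variable {k : Type*} [Field k] {n : ℕ} {A : FiniteCartanMatrix n} {q : k}
variable {B : Type*} [Ring B] [Algebra k B] {ι : LaurentFrac k n →ₐ[k] B} {Φ : Fin n → B}

/-- An intertwiner system satisfying the braid relations defines a representation of the affine
Hecke algebra. -/
def IntertwinerSystem.heckeHom (h : IntertwinerSystem A q ι Φ) (hb : BraidRelations A Φ) :
    HeckeAlgebra A q →ₐ[k] B :=
  RingQuot.liftAlgHom k ⟨FreeAlgebra.lift k fun g => match g with
    | .X r => ι (mon k (Pi.single r 1))
    | .Xinv r => ι (mon k (Pi.single r 1))⁻¹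
    | .T r => heckeOf q ι Φ r, by
    set g : FreeAlgebra k (HeckeGen n) →ₐ[k] B := FreeAlgebra.lift k fun g => match g with
      | .X r => ι (mon k (Pi.single r 1))
      | .Xinv r => ι (mon k (Pi.single r 1))⁻¹
      | .T r => heckeOf q ι Φ r with hg
    have hX (r) : g (fX k r) = ι (mon k (Pi.single r 1)) := FreeAlgebra.lift_ι_apply ..
    have hXinv (r) : g (fXinv k r) = ι (mon k (Pi.single r 1))⁻¹ := FreeAlgebra.lift_ι_apply ..
    have hT (r) : g (fT k r) = heckeOf q ι Φ r := FreeAlgebra.lift_ι_apply ..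
    have hb' := h.braidRelations_iff.mpr hb
    intro x y hxy
    cases hxy with
    | X_comm r s => rw [map_mul, map_mul, hX, hX, ← map_mul, ← map_mul, mul_comm]
    | X_mul_inv r =>
      rw [map_mul, map_one, hX, hXinv, ← map_mul, mul_inv_cancel₀ (mon_ne_zero k _), map_one]
    | inv_mul_X r =>
      rw [map_mul, map_one, hX, hXinv, ← map_mul, inv_mul_cancel₀ (mon_ne_zero k _), map_one]
    | T_X r s =>
      rw [map_mul, map_add, map_mul, map_smul, map_laurentEval hX hXinv, map_laurentEval hX hXinv,
        hX, hT, ← sub_eq_zero, ← algebraMap_lX, heckeOf_mul_sub, h.twist, sub_self]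
    | quadratic r =>
      rw [map_mul, map_add, map_sub, map_one, map_zero, AlgHom.commutes, hT,
        quadratic_heckeOf q (h.twist r), h.square, sub_self]
    | braid2 r s e => simpa only [map_mul, hT] using hb'.noEdge r s e
    | braid3 r s e => simpa only [map_mul, hT] using hb'.singleEdge r s e
    | braid4 r s e => simpa only [map_mul, map_pow, hT] using hb'.doubleEdge r s e
    | braid6 r s e => simpa only [map_mul, map_pow, hT] using hb'.tripleEdge r s e⟩

lemma IntertwinerSystem.heckeHom_hX (h : IntertwinerSystem A q ι Φ) (hb : BraidRelations A Φ)
    (r : Fin n) : h.heckeHom hb (hX A q r) = ι (mon k (Pi.single r 1)) := by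
  rw [heckeHom]
  exact (RingQuot.liftAlgHom_mkAlgHom_apply ..).trans (FreeAlgebra.lift_ι_apply ..)

lemma IntertwinerSystem.heckeHom_hT (h : IntertwinerSystem A q ι Φ) (hb : BraidRelations A Φ)
    (r : Fin n) : h.heckeHom hb (hT A q r) = heckeOf q ι Φ r := by
  rw [heckeHom]
  exact (RingQuot.liftAlgHom_mkAlgHom_apply ..).trans (FreeAlgebra.lift_ι_apply ..)

lemma IntertwinerSystem.heckeHom_ofLaurent (h : IntertwinerSystem A q ι Φ)
    (hb : BraidRelations A Φ) (f : Laurent k n) :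
    h.heckeHom hb (ofLaurent A q f) = ι (algebraMap _ _ f) := by
  refine DFunLike.congr_fun (laurent_algHom_ext (φ := (h.heckeHom hb).comp (ofLaurent A q))
    (ψ := ι.comp (IsScalarTower.toAlgHom k (Laurent k n) (LaurentFrac k n))) fun r => ?_) f
  rw [AlgHom.comp_apply, ofLaurent_lX, h.heckeHom_hX]
  rfl

/-- Two homomorphisms from the affine Hecke algebra agree if they agree on `X_r` and `T_r`. -/
lemma hecke_algHom_ext {f g : HeckeAlgebra A q →ₐ[k] B} (hX' : ∀ r, f (hX A q r) = g (hX A q r))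
    (hT' : ∀ r, f (hT A q r) = g (hT A q r)) : f = g := by
  refine RingQuot.ringQuot_ext' k f g (FreeAlgebra.hom_ext (funext fun x => ?_))
  cases x with
  | X r => exact hX' r
  | T r => exact hT' r
  | Xinv r =>
    change f ((hX A q r)⁻¹ : (HeckeAlgebra A q)ˣ) = g ((hX A q r)⁻¹ : (HeckeAlgebra A q)ˣ)
    refine left_inv_eq_right_inv (a := f (hX A q r)) ?_ ?_
    · rw [← map_mul, Units.inv_mul, map_one]
    · rw [hX', ← map_mul, Units.mul_inv, map_one]

/-- An intertwiner system satisfying the braid relations defines a homomorphism from the algebra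
presented by the intertwiners. -/
def IntertwinerSystem.presentedHom (h : IntertwinerSystem A q ι Φ) (hb : BraidRelations A Φ) :
    IntertwinerAlgebra A q →ₐ[k] B :=
  RingQuot.liftAlgHom k ⟨FreeAlgebra.lift k fun g => match g with
    | .X r => ι (mon k (Pi.single r 1))
    | .Phi r => Φ r
    | .inv f _ => ι (algebraMap (Laurent k n) _ (MvPolynomial.aeval (lX k) f))⁻¹, by
    set g : FreeAlgebra k (IntertwinerGen k n) →ₐ[k] B := FreeAlgebra.lift k fun g => match g with
      | .X r => ι (mon k (Pi.single r 1))
      | .Phi r => Φ r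
      | .inv f _ => ι (algebraMap (Laurent k n) _ (MvPolynomial.aeval (lX k) f))⁻¹ with hg
    have hc : CompatibleEval ι g :=
      ⟨fun r => FreeAlgebra.lift_ι_apply .., fun f hf => FreeAlgebra.lift_ι_apply ..⟩
    have hΦ (r) : g (gPhi k r) = Φ r := FreeAlgebra.lift_ι_apply ..
    have hne (f : MvPolynomial (Fin n) k) (hf : f ≠ 0) :
        algebraMap (Laurent k n) (LaurentFrac k n) (MvPolynomial.aeval (lX k) f) ≠ 0 :=
      (map_ne_zero_iff _ (IsFractionRing.injective (Laurent k n) _)).mpr (aeval_lX_ne_zero hf)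
    intro x y hxy
    cases hxy with
    | X_comm r s => rw [map_mul, map_mul, hc.X, hc.X, ← map_mul, ← map_mul, mul_comm]
    | mul_inv f hf =>
      rw [map_mul, map_one, hc.map_gPoly, hc.inv, ← map_mul, mul_inv_cancel₀ (hne f hf), map_one]
    | inv_mul f hf =>
      rw [map_mul, map_one, hc.map_gPoly, hc.inv, ← map_mul, inv_mul_cancel₀ (hne f hf), map_one]
    | Phi_X r s => rw [map_mul, map_mul, hc.map_reflection, hc.X, hΦ, h.twist]
    | Phi_sq r => rw [hc.map_square, pow_two, map_mul, hΦ, h.square]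
    | braid2 r s e => simpa only [map_mul, hΦ] using hb.noEdge r s e
    | braid3 r s e => simpa only [map_mul, hΦ] using hb.singleEdge r s e
    | braid4 r s e => simpa only [map_mul, map_pow, hΦ] using hb.doubleEdge r s e
    | braid6 r s e => simpa only [map_mul, map_pow, hΦ] using hb.tripleEdge r s e⟩

lemma IntertwinerSystem.presentedHom_X (h : IntertwinerSystem A q ι Φ) (hb : BraidRelations A Φ)
    (r : Fin n) :
    h.presentedHom hb (IntertwinerAlgebra.gen A q (.X r)) = ι (mon k (Pi.single r 1)) := by
  rw [presentedHom]
  exact (RingQuot.liftAlgHom_mkAlgHom_apply ..).trans (FreeAlgebra.lift_ι_apply ..)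

lemma IntertwinerSystem.presentedHom_Phi (h : IntertwinerSystem A q ι Φ) (hb : BraidRelations A Φ)
    (r : Fin n) : h.presentedHom hb (IntertwinerAlgebra.gen A q (.Phi r)) = Φ r := by
  rw [presentedHom]
  exact (RingQuot.liftAlgHom_mkAlgHom_apply ..).trans (FreeAlgebra.lift_ι_apply ..)

lemma IntertwinerSystem.presentedHom_inv (h : IntertwinerSystem A q ι Φ) (hb : BraidRelations A Φ)
    (f : MvPolynomial (Fin n) k) (hf : f ≠ 0) :
    h.presentedHom hb (IntertwinerAlgebra.gen A q (.inv f hf)) =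
      ι (algebraMap (Laurent k n) _ (MvPolynomial.aeval (lX k) f))⁻¹ := by
  rw [presentedHom]
  exact (RingQuot.liftAlgHom_mkAlgHom_apply ..).trans (FreeAlgebra.lift_ι_apply ..)

end UniversalProperties

/-! ### The presented algebra -/

section Presented

variable {k : Type*} [Field k] {n : ℕ} (A : FiniteCartanMatrix n) (q : k)

lemma mk_gPoly_mul_gInv (f : MvPolynomial (Fin n) k) (hf : f ≠ 0) :
    RingQuot.mkAlgHom k (IntertwinerRel A q) (gPoly f) *
      RingQuot.mkAlgHom k (IntertwinerRel A q) (gInv f hf) = 1 := by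
  rw [← map_mul, RingQuot.mkAlgHom_rel k (IntertwinerRel.mul_inv f hf), map_one]

lemma mk_gInv_mul_gPoly (f : MvPolynomial (Fin n) k) (hf : f ≠ 0) :
    RingQuot.mkAlgHom k (IntertwinerRel A q) (gInv f hf) *
      RingQuot.mkAlgHom k (IntertwinerRel A q) (gPoly f) = 1 := by
  rw [← map_mul, RingQuot.mkAlgHom_rel k (IntertwinerRel.inv_mul f hf), map_one]

/-- The generator `X_r` of the presented algebra, as a unit. -/
def presentedX (r : Fin n) : (IntertwinerAlgebra A q)ˣ where
  val := RingQuot.mkAlgHom k (IntertwinerRel A q) (gX k r)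
  inv := RingQuot.mkAlgHom k (IntertwinerRel A q)
    (gInv (MvPolynomial.X r) (MvPolynomial.X_ne_zero r))
  val_inv := by rw [← gPoly_X, mk_gPoly_mul_gInv]
  inv_val := by rw [← gPoly_X, mk_gInv_mul_gPoly]

/-- Laurent polynomials in the presented algebra. -/
def presentedLaurent : Laurent k n →ₐ[k] IntertwinerAlgebra A q :=
  laurentLift (presentedX A q) fun r s => Units.ext <| by
    change RingQuot.mkAlgHom k (IntertwinerRel A q) (gX k r) *
      RingQuot.mkAlgHom k (IntertwinerRel A q) (gX k s) =
      RingQuot.mkAlgHom k (IntertwinerRel A q) (gX k s) *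
      RingQuot.mkAlgHom k (IntertwinerRel A q) (gX k r)
    rw [← map_mul, RingQuot.mkAlgHom_rel k (IntertwinerRel.X_comm r s), map_mul]

lemma presentedLaurent_lX (r : Fin n) :
    presentedLaurent A q (lX k r) = RingQuot.mkAlgHom k (IntertwinerRel A q) (gX k r) :=
  laurentLift_lX ..

/-- Only polynomials are inverted by the relations. A Laurent polynomial times a unit is a
polynomial, and commuting factors of a unit are units. -/
lemma isUnit_presentedLaurent (f : Laurent k n) (hf : f ≠ 0) :
    IsUnit (presentedLaurent A q f) := by
  obtain ⟨m, p, hm, hp⟩ := exists_mul_aeval_lX_eq f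
  have hp0 : p ≠ 0 := by
    rintro rfl
    rw [map_zero] at hp
    exact (mul_ne_zero hf hm.ne_zero) hp
  have hu : IsUnit (presentedLaurent A q (MvPolynomial.aeval (lX k) p)) := by
    rw [← map_gPoly (fun r => (presentedLaurent_lX A q r).symm)]
    exact ⟨⟨_, _, mk_gPoly_mul_gInv A q p hp0, mk_gInv_mul_gPoly A q p hp0⟩, rfl⟩
  rw [← hp, map_mul, ((Commute.all f _).map (presentedLaurent A q)).isUnit_mul_iff] at hu
  exact hu.1

/-- Rational functions in the presented algebra. -/
def presentedFrac : LaurentFrac k n →ₐ[k] IntertwinerAlgebra A q :=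
  fracLift (presentedLaurent A q) (isUnit_presentedLaurent A q)

lemma presentedFrac_algebraMap (f : Laurent k n) :
    presentedFrac A q (algebraMap _ _ f) = presentedLaurent A q f :=
  fracLift_algebraMap ..

/-- By uniqueness of inverses, the formal generator f⁻¹ is the image of the rational function 1/f.
-/
lemma compatibleEval_mk :
    CompatibleEval (presentedFrac A q) (RingQuot.mkAlgHom k (IntertwinerRel A q)) where
  X r := by rw [← algebraMap_lX, presentedFrac_algebraMap, presentedLaurent_lX]
  inv f hf := by
    refine left_inv_eq_right_inv (mk_gInv_mul_gPoly A q f hf) ?_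
    rw [map_gPoly (fun r => (presentedLaurent_lX A q r).symm), ← presentedFrac_algebraMap,
      ← map_mul, mul_inv_cancel₀, map_one]
    exact (map_ne_zero_iff _ (IsFractionRing.injective (Laurent k n) _)).mpr (aeval_lX_ne_zero hf)

lemma presentedSystem : IntertwinerSystem A q (presentedFrac A q)
    fun r => IntertwinerAlgebra.gen A q (.Phi r) where
  twist r := by
    refine twist_of_twist_lX _ fun s => ?_
    rw [← (compatibleEval_mk A q).map_reflection, ← (compatibleEval_mk A q).X]
    change RingQuot.mkAlgHom k _ (gPhi k r) * _ = _ * RingQuot.mkAlgHom k _ (gPhi k r)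
    rw [← map_mul, ← map_mul, RingQuot.mkAlgHom_rel k (IntertwinerRel.Phi_X r s)]
  square r := by
    rw [← (compatibleEval_mk A q).map_square]
    change RingQuot.mkAlgHom k _ (gPhi k r) * RingQuot.mkAlgHom k _ (gPhi k r) = _
    rw [← map_mul, ← pow_two, RingQuot.mkAlgHom_rel k (IntertwinerRel.Phi_sq r)]

lemma presented_braidRelations :
    BraidRelations A fun r => IntertwinerAlgebra.gen A q (.Phi r) where
  noEdge r s e := by
    have h := RingQuot.mkAlgHom_rel k (IntertwinerRel.braid2 (A := A) (q := q) r s e)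
    simp only [map_mul] at h
    exact h
  singleEdge r s e := by
    have h := RingQuot.mkAlgHom_rel k (IntertwinerRel.braid3 (A := A) (q := q) r s e)
    simp only [map_mul] at h
    exact h
  doubleEdge r s e := by
    have h := RingQuot.mkAlgHom_rel k (IntertwinerRel.braid4 (A := A) (q := q) r s e)
    simp only [map_mul, map_pow] at h
    exact h
  tripleEdge r s e := by
    have h := RingQuot.mkAlgHom_rel k (IntertwinerRel.braid6 (A := A) (q := q) r s e)
    simp only [map_mul, map_pow] at h
    exact h

end Presented

/-! ### Invariant rational functions -/

section InvariantFractions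

variable {k : Type*} [Field k] {n : ℕ} {A : FiniteCartanMatrix n}

variable (k A) in
/-- The embedding of the quotient field of the invariants into the rational functions. -/
def invariantsFrac : FractionRing (invariants k A) →+* LaurentFrac k n :=
  IsFractionRing.map (j := (invariants k A).val.toRingHom) Subtype.val_injective

lemma invariantsFrac_algebraMap (z : invariants k A) :
    invariantsFrac k A (algebraMap _ _ z) = algebraMap (Laurent k n) _ z := by
  unfold invariantsFrac IsFractionRing.map
  exact IsLocalization.map_eq _ z

lemma fracReflection_invariantsFrac (r : Fin n) (y : FractionRing (invariants k A)) :
    fracReflection k A r (invariantsFrac k A y) = invariantsFrac k A y := by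
  have h : (fracReflection k A r).comp (invariantsFrac k A) = invariantsFrac k A := by
    refine IsLocalization.ringHom_ext (nonZeroDivisors (invariants k A)) (RingHom.ext fun z => ?_)
    simp only [RingHom.comp_apply, invariantsFrac_algebraMap, fracReflection_algebraMap]
    rw [z.2 _ (Subgroup.subset_closure ⟨r, rfl⟩)]
  exact DFunLike.congr_fun h y

end InvariantFractions

/-! ### Algebras over the Hecke algebra in which Laurent polynomials are invertible -/

section Extension

variable {k : Type*} [Field k] {n : ℕ} {A : FiniteCartanMatrix n} {q : k}
  {B : Type*} [Ring B] [Algebra k B] (i : HeckeAlgebra A q →ₐ[k] B)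

/-- The element `T_r + (1 - q)(1 - X_r)⁻¹` in an algebra over the Hecke algebra. -/
def intertwinerOf (r : Fin n) : B :=
  i (hT A q r) + (1 - q) • Ring.inverse (i (ofLaurent A q (1 - lX k r)))

variable (hi : ∀ f : Laurent k n, f ≠ 0 → IsUnit (i (ofLaurent A q f)))

/-- Rational functions in an algebra over the Hecke algebra in which nonzero Laurent polynomials
are invertible. -/
def fracOf : LaurentFrac k n →ₐ[k] B := fracLift (i.comp (ofLaurent A q)) hi

lemma fracOf_algebraMap (f : Laurent k n) : fracOf i hi (algebraMap _ _ f) = i (ofLaurent A q f) :=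
  fracLift_algebraMap ..

lemma inverse_ofLaurent (f : Laurent k n) (hf : f ≠ 0) :
    Ring.inverse (i (ofLaurent A q f)) = fracOf i hi (algebraMap _ _ f)⁻¹ := by
  rw [← fracOf_algebraMap i hi]
  exact ringInverse_map (fracOf i hi).toRingHom
    ((map_ne_zero_iff _ (IsFractionRing.injective (Laurent k n) _)).mpr hf)

/-- Because (1 - q)/(1 - X_r) + c_r - 1 = 0, the passages from T to Φ and from Φ to T undo each
other. -/
lemma heckeOf_intertwinerOf (r : Fin n) :
    heckeOf q (fracOf i hi) (intertwinerOf i) r = i (hT A q r) := by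
  have h1 := one_sub_mon_ne_zero k (single_ne_zero r)
  have hc : (1 - q) • (1 - mon k (Pi.single r 1))⁻¹ + cFun k q (Pi.single r 1) - 1 = 0 := by
    rw [Algebra.smul_def, map_sub, map_one, cFun]
    field_simp
    ring
  have hc' := congrArg (fracOf i hi) hc
  rw [map_sub, map_add, map_smul, map_one, map_zero] at hc'
  rw [heckeOf, intertwinerOf, inverse_ofLaurent i hi _ (one_sub_lX_ne_zero r), map_sub, map_one,
    algebraMap_lX, add_assoc, add_sub_assoc, hc', add_zero]

/-- The Hecke relations say that the defects on the T side vanish, hence so do those on the Φ side.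
The twist comes first, since the equality of the quadratic defects presupposes it. -/
lemma intertwinerSystem_intertwinerOf : IntertwinerSystem A q (fracOf i hi) (intertwinerOf i) := by
  have htwist (r : Fin n) (f : LaurentFrac k n) : intertwinerOf i r * fracOf i hi f =
      fracOf i hi (fracReflection k A r f) * intertwinerOf i r := by
    refine twist_of_twist_lX _ (fun s => ?_) f
    rw [← algebraMap_lX, ← sub_eq_zero, ← heckeOf_mul_sub q, heckeOf_intertwinerOf,
      fracOf_algebraMap, fracOf_algebraMap, fracOf_algebraMap, ← map_mul, ← map_mul,
      hT_mul_ofLaurent, map_add, map_smul]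
    abel
  refine ⟨htwist, fun r => ?_⟩
  rw [← sub_eq_zero, ← quadratic_heckeOf q (htwist r), heckeOf_intertwinerOf]
  have h := congrArg i (RingQuot.mkAlgHom_rel k (HeckeRel.quadratic (A := A) (q := q) r))
  rw [map_mul, map_add, map_sub, map_one, map_zero, AlgHom.commutes, map_mul, map_add, map_sub,
    map_one, map_zero, AlgHom.commutes] at h
  exact h

lemma braidRelations_intertwinerOf
    (hi : ∀ f : Laurent k n, f ≠ 0 → IsUnit (i (ofLaurent A q f))) :
    BraidRelations A (intertwinerOf i) := by
  rw [← (intertwinerSystem_intertwinerOf i hi).braidRelations_iff]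
  have key (r : Fin n) : heckeOf q (fracOf i hi) (intertwinerOf i) r =
      (i.comp (RingQuot.mkAlgHom k (HeckeRel A q))) (fT k r) := heckeOf_intertwinerOf i hi r
  have hrel {x y : FreeAlgebra k (HeckeGen n)} (h : HeckeRel A q x y) :
      (i.comp (RingQuot.mkAlgHom k (HeckeRel A q))) x =
      (i.comp (RingQuot.mkAlgHom k (HeckeRel A q))) y :=
    congrArg i (RingQuot.mkAlgHom_rel k h)
  refine ⟨fun r s e => ?_, fun r s e => ?_, fun r s e => ?_, fun r s e => ?_⟩
  · rw [key, key, ← map_mul, ← map_mul, hrel (.braid2 r s e)]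
  · rw [key, key, ← map_mul, ← map_mul, ← map_mul, ← map_mul, hrel (.braid3 r s e)]
  · rw [key, key, ← map_mul, ← map_mul, ← map_pow, ← map_pow, hrel (.braid4 r s e)]
  · rw [key, key, ← map_mul, ← map_mul, ← map_pow, ← map_pow, hrel (.braid6 r s e)]

/-- The homomorphism from the presented algebra given by the intertwiners. -/
def ofPresented : IntertwinerAlgebra A q →ₐ[k] B :=
  (intertwinerSystem_intertwinerOf i hi).presentedHom (braidRelations_intertwinerOf i hi)

lemma ofPresented_X (r : Fin n) :
    ofPresented i hi (IntertwinerAlgebra.gen A q (.X r)) = i (ofLaurent A q (lX k r)) := by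
  rw [← fracOf_algebraMap i hi, algebraMap_lX]
  exact (intertwinerSystem_intertwinerOf i hi).presentedHom_X (braidRelations_intertwinerOf i hi) r

lemma ofPresented_Phi (r : Fin n) :
    ofPresented i hi (IntertwinerAlgebra.gen A q (.Phi r)) = intertwinerOf i r :=
  (intertwinerSystem_intertwinerOf i hi).presentedHom_Phi (braidRelations_intertwinerOf i hi) r

lemma ofPresented_inv (f : MvPolynomial (Fin n) k) (hf : f ≠ 0) :
    ofPresented i hi (IntertwinerAlgebra.gen A q (.inv f hf)) =
      Ring.inverse (i (ofLaurent A q (MvPolynomial.aeval (lX k) f))) := by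
  rw [inverse_ofLaurent i hi _ (aeval_lX_ne_zero hf)]
  exact (intertwinerSystem_intertwinerOf i hi).presentedHom_inv
    (braidRelations_intertwinerOf i hi) f hf

lemma ofPresented_presentedFrac (f : LaurentFrac k n) :
    ofPresented i hi (presentedFrac A q f) = fracOf i hi f := by
  have h : (ofPresented i hi).comp (presentedFrac A q) = fracOf i hi := by
    refine laurentFrac_algHom_ext fun r => ?_
    rw [AlgHom.comp_apply, ← (compatibleEval_mk A q).X]
    exact (intertwinerSystem_intertwinerOf i hi).presentedHom_X
      (braidRelations_intertwinerOf i hi) r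
  exact DFunLike.congr_fun h f

/-- Half of the proof that the two homomorphisms are inverse: the composite fixes the image of the
Hecke algebra. -/
lemma ofPresented_heckeHom (x : HeckeAlgebra A q) :
    ofPresented i hi ((presentedSystem A q).heckeHom (presented_braidRelations A q) x) = i x := by
  have h : (ofPresented i hi).comp
      ((presentedSystem A q).heckeHom (presented_braidRelations A q)) = i := by
    refine hecke_algHom_ext (fun r => ?_) fun r => ?_
    · rw [AlgHom.comp_apply, IntertwinerSystem.heckeHom_hX, ofPresented_presentedFrac,
        ← algebraMap_lX, fracOf_algebraMap, ofLaurent_lX]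
    · rw [AlgHom.comp_apply, IntertwinerSystem.heckeHom_hT, heckeOf, map_sub, map_add, map_one,
        ofPresented_presentedFrac, ofPresented_Phi]
      exact heckeOf_intertwinerOf i hi r
  exact DFunLike.congr_fun h x

/-- A homomorphism to the presented algebra compatible with the Hecke algebra is a left inverse of
`ofPresented`. -/
lemma leftInverse_ofPresented (β : B →ₐ[k] IntertwinerAlgebra A q)
    (hβ : ∀ x, β (i x) = (presentedSystem A q).heckeHom (presented_braidRelations A q) x)
    (x : IntertwinerAlgebra A q) : β (ofPresented i hi x) = x := by
  have hfrac (f : LaurentFrac k n) : β (fracOf i hi f) = presentedFrac A q f := by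
    have h : β.comp (fracOf i hi) = presentedFrac A q := by
      refine laurentFrac_algHom_ext fun r => ?_
      rw [AlgHom.comp_apply, ← algebraMap_lX, fracOf_algebraMap, hβ,
        IntertwinerSystem.heckeHom_ofLaurent]
    exact DFunLike.congr_fun h f
  have h : β.comp (ofPresented i hi) = AlgHom.id k _ := by
    refine RingQuot.ringQuot_ext' k _ _ (FreeAlgebra.hom_ext (funext fun g => ?_))
    cases g with
    | X r =>
      change β (ofPresented i hi (RingQuot.mkAlgHom k (IntertwinerRel A q) (gX k r))) =
        RingQuot.mkAlgHom k (IntertwinerRel A q) (gX k r)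
      rw [(compatibleEval_mk A q).X, ofPresented_presentedFrac, hfrac]
    | inv f hf =>
      change β (ofPresented i hi (RingQuot.mkAlgHom k (IntertwinerRel A q) (gInv f hf))) =
        RingQuot.mkAlgHom k (IntertwinerRel A q) (gInv f hf)
      rw [(compatibleEval_mk A q).inv, ofPresented_presentedFrac, hfrac]
    | Phi r =>
      change β (ofPresented i hi (IntertwinerAlgebra.gen A q (.Phi r))) =
        IntertwinerAlgebra.gen A q (.Phi r)
      have h1 := heckeOf_intertwinerOf i hi r
      rw [heckeOf] at h1
      have h2 := congrArg β h1
      rw [map_sub, map_add, map_one, hfrac, hβ, IntertwinerSystem.heckeHom_hT, heckeOf] at h2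
      rw [ofPresented_Phi]
      -- Both T_r and c_r are already known to be respected, so Φ_r = T_r + 1 - c_r is too.
      exact add_right_cancel (sub_left_inj.mp h2)
  exact DFunLike.congr_fun h x

/-- An invariant rational function reaches `B` through k(X₁, …, Xₙ) or directly through `j`; the two
agree because they do on invariant Laurent polynomials. -/
lemma fracOf_invariantsFrac (j : FractionRing (invariants k A) →+* B)
    (hj : ∀ z : invariants k A, j (algebraMap _ _ z) = i (ofLaurent A q z))
    (y : FractionRing (invariants k A)) : fracOf i hi (invariantsFrac k A y) = j y := by
  have h : (fracOf i hi).toRingHom.comp (invariantsFrac k A) = j := by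
    refine IsLocalization.ringHom_ext (nonZeroDivisors (invariants k A)) (RingHom.ext fun z => ?_)
    change fracOf i hi (invariantsFrac k A (algebraMap _ _ z)) = j (algebraMap _ _ z)
    rw [invariantsFrac_algebraMap, fracOf_algebraMap, hj]
  exact DFunLike.congr_fun h y

/-- The isomorphism from the presented algebra given by the intertwiners, for an algebra generated
by the images of the Hecke algebra and of the quotient field of the invariants, with a compatible
homomorphism to the presented algebra. -/
def equivOfPresented (j : FractionRing (invariants k A) →+* B)
    (hj : ∀ z : invariants k A, j (algebraMap _ _ z) = i (ofLaurent A q z))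
    (hij : ∀ f : B →+* B, (∀ x, f (i x) = i x) → (∀ y, f (j y) = j y) → ∀ b, f b = b)
    (β : B →ₐ[k] IntertwinerAlgebra A q)
    (hβi : ∀ x, β (i x) = (presentedSystem A q).heckeHom (presented_braidRelations A q) x)
    (hβj : ∀ y, β (j y) = presentedFrac A q (invariantsFrac k A y)) :
    IntertwinerAlgebra A q ≃ₐ[k] B :=
  AlgEquiv.ofAlgHom (ofPresented i hi) β
    (AlgHom.ext (hij ((ofPresented i hi).comp β).toRingHom
      (fun x => (congrArg _ (hβi x)).trans (ofPresented_heckeHom i hi x))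
      fun y => ((congrArg _ (hβj y)).trans (ofPresented_presentedFrac i hi _)).trans
        (fracOf_invariantsFrac i hi j hj y)))
    (AlgHom.ext (leftInverse_ofPresented i hi β hβi))

/-- Invariant rational functions are central in the presented algebra. -/
lemma presentedFrac_central (y : FractionRing (invariants k A)) (b : IntertwinerAlgebra A q) :
    Commute (presentedFrac A q (invariantsFrac k A y)) b := by
  obtain ⟨b, rfl⟩ := RingQuot.mkAlgHom_surjective k (IntertwinerRel A q) b
  induction b using FreeAlgebra.induction with
  | grade0 c =>
    rw [AlgHom.commutes]
    exact Algebra.commute_algebraMap_right _ _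
  | grade1 g =>
    cases g with
    | X r =>
      change Commute _ (RingQuot.mkAlgHom k (IntertwinerRel A q) (gX k r))
      rw [(compatibleEval_mk A q).X]
      exact (Commute.all _ _).map (presentedFrac A q)
    | inv f hf =>
      change Commute _ (RingQuot.mkAlgHom k (IntertwinerRel A q) (gInv f hf))
      rw [(compatibleEval_mk A q).inv]
      exact (Commute.all _ _).map (presentedFrac A q)
    | Phi r =>
      have h := (presentedSystem A q).twist r (invariantsFrac k A y)
      rw [fracReflection_invariantsFrac] at h
      exact h.symm
  | mul a b ha hb => rw [map_mul]; exact ha.mul_right hb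
  | add a b ha hb => rw [map_add]; exact ha.add_right hb

end Extension

/-! ### The rationalization -/

section Rationalization

variable {k : Type*} [Field k] {n : ℕ} (A : FiniteCartanMatrix n) (q : k)

/-- An invariant may cross the tensor sign, which puts it in a field and makes it invertible when
nonzero. -/
lemma ratOfLaurent_eq_one_tmul (z : invariants k A) :
    ratOfLaurent A q z = 1 ⊗ₜ[invariants k A] algebraMap _ (FractionRing (invariants k A)) z :=
  Algebra.TensorProduct.tmul_one_eq_one_tmul z

/-- Nonzero Laurent polynomials are invertible in the rationalization. -/
lemma isUnit_ratOfLaurent (f : Laurent k n) (hf : f ≠ 0) : IsUnit (ratOfLaurent A q f) := by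
  obtain ⟨g, hg, hg0⟩ := exists_mul_mem_invariants A f hf
  have hz : (⟨f * g, hg⟩ : invariants k A) ≠ 0 := fun h => hg0 (congrArg Subtype.val h)
  have hz' : algebraMap _ (FractionRing (invariants k A)) (⟨f * g, hg⟩ : invariants k A) ≠ 0 :=
    (map_ne_zero_iff _ (IsFractionRing.injective _ _)).mpr hz
  have hu : IsUnit (ratOfLaurent A q (f * g)) := by
    rw [ratOfLaurent_eq_one_tmul A q ⟨f * g, hg⟩]
    exact hz'.isUnit.map (Algebra.TensorProduct.includeRight :
      FractionRing (invariants k A) →ₐ[invariants k A] Rationalization A q)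
  rw [map_mul, ((Commute.all f g).map (ratOfLaurent A q)).isUnit_mul_iff] at hu
  exact hu.1

/-- The presented algebra as an algebra over the invariants. -/
abbrev presentedInvariantsAlgebra : Algebra (invariants k A) (IntertwinerAlgebra A q) :=
  ((presentedFrac A q).toRingHom.comp ((invariantsFrac k A).comp
    (algebraMap (invariants k A) (FractionRing (invariants k A))))).toAlgebra' fun _ b =>
      presentedFrac_central _ b

/-- The Hecke algebra in the rationalization. -/
def ratOfHecke : HeckeAlgebra A q →ₐ[k] Rationalization A q :=
  Algebra.TensorProduct.includeLeft (R := invariants k A) (S := k)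

/-- The quotient field of the invariants in the rationalization. -/
def ratOfInvariantsFrac : FractionRing (invariants k A) →+* Rationalization A q :=
  (Algebra.TensorProduct.includeRight :
      FractionRing (invariants k A) →ₐ[invariants k A] Rationalization A q).toRingHom

/-- The ring homomorphism from the rationalization to the presented algebra. -/
def ratToPresentedRingHom : Rationalization A q →+* IntertwinerAlgebra A q :=
  letI := presentedInvariantsAlgebra A q
  letI α := (presentedSystem A q).heckeHom (presented_braidRelations A q)
  (Algebra.TensorProduct.lift (R := invariants k A) (S := invariants k A)
      (A := HeckeAlgebra A q) (B := FractionRing (invariants k A)) (C := IntertwinerAlgebra A q)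
      { α.toRingHom with
        commutes' := fun z => by
          refine ((presentedSystem A q).heckeHom_ofLaurent
            (presented_braidRelations A q) z).trans ?_
          rw [← invariantsFrac_algebraMap]
          rfl }
      { (presentedFrac A q).toRingHom.comp (invariantsFrac k A) with
        commutes' := fun _ => rfl }
      -- The images of the two tensor factors must commute; this holds because Φ_r commutes with
      -- rational functions fixed by σ_r.
      (fun x y => (presentedFrac_central y (α x)).symm)).toRingHom

lemma ratToPresentedRingHom_tmul (x : HeckeAlgebra A q) (y : FractionRing (invariants k A)) :
    ratToPresentedRingHom A q (x ⊗ₜ y) =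
      (presentedSystem A q).heckeHom (presented_braidRelations A q) x *
        presentedFrac A q (invariantsFrac k A y) := rfl

lemma ratToPresentedRingHom_ratOfHecke (x : HeckeAlgebra A q) :
    ratToPresentedRingHom A q (ratOfHecke A q x) =
      (presentedSystem A q).heckeHom (presented_braidRelations A q) x := by
  refine (ratToPresentedRingHom_tmul A q x 1).trans ?_
  rw [RingHom.map_one, map_one, mul_one]

/-- The homomorphism from the rationalization to the presented algebra. -/
def ratToPresented : Rationalization A q →ₐ[k] IntertwinerAlgebra A q where
  __ := ratToPresentedRingHom A q
  commutes' c := by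
    refine (congrArg (ratToPresentedRingHom A q) ((ratOfHecke A q).commutes c).symm).trans ?_
    exact (ratToPresentedRingHom_ratOfHecke A q _).trans (AlgHom.commutes _ c)

lemma ratToPresentedRingHom_ratOfInvariantsFrac (y : FractionRing (invariants k A)) :
    ratToPresentedRingHom A q (ratOfInvariantsFrac A q y) =
      presentedFrac A q (invariantsFrac k A y) := by
  refine (ratToPresentedRingHom_tmul A q 1 y).trans ?_
  rw [map_one, one_mul]

lemma tmul_eq_mul (x : HeckeAlgebra A q) (y : FractionRing (invariants k A)) :
    (x ⊗ₜ y : Rationalization A q) = ratOfHecke A q x * ratOfInvariantsFrac A q y := by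
  refine Eq.trans ?_ (Algebra.TensorProduct.tmul_mul_tmul x 1 1 y).symm
  rw [mul_one, one_mul]

/-- The two tensor factors generate, so this is how the composite through the presented algebra is
recognized as the identity. -/
lemma ratRingHom_apply_eq_self (f : Rationalization A q →+* Rationalization A q)
    (hx : ∀ x, f (ratOfHecke A q x) = ratOfHecke A q x)
    (hy : ∀ y, f (ratOfInvariantsFrac A q y) = ratOfInvariantsFrac A q y)
    (b : Rationalization A q) : f b = b := by
  induction b using TensorProduct.induction_on with
  | zero => exact RingHom.map_zero f
  | add x y hx hy => exact (RingHom.map_add f x y).trans (congrArg₂ (· + ·) hx hy)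
  | tmul x y =>
    rw [tmul_eq_mul]
    exact (RingHom.map_mul f _ _).trans (congrArg₂ (· * ·) (hx x) (hy y))

/-- The canonical isomorphism between the presented algebra and the rationalization. -/
def presentedEquivRat : IntertwinerAlgebra A q ≃ₐ[k] Rationalization A q :=
  equivOfPresented (B := Rationalization A q) (ratOfHecke A q) (isUnit_ratOfLaurent A q)
    (ratOfInvariantsFrac A q) (fun z => (ratOfLaurent_eq_one_tmul A q z).symm)
    (ratRingHom_apply_eq_self A q) (ratToPresented A q) (ratToPresentedRingHom_ratOfHecke A q)
    (ratToPresentedRingHom_ratOfInvariantsFrac A q)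

lemma ratOfHecke_ofLaurent (f : Laurent k n) :
    ratOfHecke A q (ofLaurent A q f) = ratOfLaurent A q f := rfl

lemma intertwinerOf_ratOfHecke (r : Fin n) :
    intertwinerOf (B := Rationalization A q) (ratOfHecke A q) r = intertwiner A q r := rfl

lemma presentedEquivRat_apply (x : IntertwinerAlgebra A q) :
    presentedEquivRat A q x =
      ofPresented (B := Rationalization A q) (ratOfHecke A q) (isUnit_ratOfLaurent A q) x := rfl

lemma presentedEquivRat_X (r : Fin n) :
    presentedEquivRat A q (IntertwinerAlgebra.gen A q (.X r)) = ratOfLaurent A q (lX k r) := by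
  have h := ofPresented_X (B := Rationalization A q) (ratOfHecke A q) (isUnit_ratOfLaurent A q) r
  rw [presentedEquivRat_apply, ← ratOfHecke_ofLaurent]
  with_reducible_and_instances exact h

lemma presentedEquivRat_Phi (r : Fin n) :
    presentedEquivRat A q (IntertwinerAlgebra.gen A q (.Phi r)) = intertwiner A q r := by
  have h := ofPresented_Phi (B := Rationalization A q) (ratOfHecke A q) (isUnit_ratOfLaurent A q) r
  rw [presentedEquivRat_apply, ← intertwinerOf_ratOfHecke]
  with_reducible_and_instances exact h

lemma presentedEquivRat_inv (f : MvPolynomial (Fin n) k) (hf : f ≠ 0) :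
    presentedEquivRat A q (IntertwinerAlgebra.gen A q (.inv f hf)) =
      Ring.inverse (ratOfPoly A q f) := by
  have h := ofPresented_inv (B := Rationalization A q) (ratOfHecke A q)
    (isUnit_ratOfLaurent A q) f hf
  rw [presentedEquivRat_apply, ratOfPoly, AlgHom.comp_apply, ← ratOfHecke_ofLaurent]
  with_reducible_and_instances exact h

end Rationalization

end AffineHecke

end

theorem proposition4 {k : Type*} [Field k] {n : ℕ} (A : AffineHecke.FiniteCartanMatrix n)
    (q : k) (hq0 : q ≠ 0) (hq1 : q ≠ 1) :
    -- nonzero Laurent polynomials are invertible in the rationalization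
    (∀ f : AffineHecke.Laurent k n, f ≠ 0 → IsUnit (AffineHecke.ratOfLaurent A q f)) ∧
    -- the presented algebra is isomorphic to the rationalization, compatibly with generators
    ∃ e : AffineHecke.IntertwinerAlgebra A q ≃ₐ[k] AffineHecke.Rationalization A q,
      (∀ r, e (AffineHecke.IntertwinerAlgebra.gen A q (.X r)) =
        AffineHecke.ratOfLaurent A q (AffineHecke.lX k r)) ∧
      (∀ r, e (AffineHecke.IntertwinerAlgebra.gen A q (.Phi r)) = AffineHecke.intertwiner A q r) ∧
      (∀ f hf, e (AffineHecke.IntertwinerAlgebra.gen A q (.inv f hf)) =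
        Ring.inverse (AffineHecke.ratOfPoly A q f)) := by
  exact ⟨AffineHecke.isUnit_ratOfLaurent A q, AffineHecke.presentedEquivRat A q,
    AffineHecke.presentedEquivRat_X A q, AffineHecke.presentedEquivRat_Phi A q,
    AffineHecke.presentedEquivRat_inv A q⟩
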